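/- A weight on $\mathbb R^n$ ($n\ge 1$) is a non-negative locally integrable function; $R$ denotes bounded non-degenerate rectangles in $\mathbb R^n$ with sides parallel to the coordinate axes. For a weight $v$ on $\mathbb R$ let \[ [v]_{A_\infty}=\sup_I \frac{1}{v(I)}\int_I \mathsf M(v\mathbf 1_I),\qquad v(I)=\int_I v , \] where $I$ ranges over the bounded non-degenerate intervals (with $0/0=0$) and $\mathsf M$ is the non-centered Hardy--Littlewood maximal operator on $\mathbb R$. For a weight $w$ on $\mathbb R^n$ let \[ [w]_{A_\infty^*}=\sup_{1\le j\le n}\ \operatorname*{ess\,sup}_{\bar x^j\in\mathbb R^{n-1}} [w_{\bar x^j}]_{A_\infty}, \] where $\bar x^j=(x_1,\dots,x_{j-1},x_{j+1},\dots,x_n)$ and $w_{\bar x^j}(t)=w(x_1,\dots,x_{j-1},t,x_{j+1},\dots,x_n)$; write $w\in A_\infty^*$ if $[w]_{A_\infty^*}<\infty$. (i) There are a numerical constant $c>1$ and constants $C_n$ depending only on $n$ such that, for every $n\ge 1$, every $w\in A_\infty^*$ on $\mathbb R^n$, every $R$ and every $r$ with $1\le r<1+\frac{1}{cn[w]_{A_\infty^*}-1}$,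 \[ \Big(\frac1{|R|}\int_R w^r\Big)^{\frac1r}\le \frac{C_n}{\big(1-(r-1)(cn[w]_{A_\infty^*}-1)\big)^{1/r}}\ \frac1{|R|}\int_R w . \] (ii) The exponent is optimal up to dimensional constants: there is a numerical constant $K>0$ such that, for every $n\ge 1$, if a weight $w$ on $\mathbb R^n$ satisfies, for some $r>1$ and $B\ge 1$, \[ \Big(\frac1{|R|}\int_R w^r\Big)^{\frac1r}\le B\,\frac1{|R|}\int_R w\qquad\text{for all } R, \] then $w\in A_\infty^*$ and $[w]_{A_\infty^*}\le K\,r'\,(1+\ln B)$, where $r'=r/(r-1)$. -/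

import Mathlib

open MeasureTheory
open scoped ENNReal

namespace StrongWeights

/-- The average of a nonnegative function over a set, with respect to Lebesgue measure; the value
is the honest one in `[0, ∞]` (there is no integrability requirement and no junk value). -/
noncomputable def avg {X : Type*} [MeasureSpace X] (S : Set X) (f : X → ℝ≥0∞) : ℝ≥0∞ :=
  (∫⁻ x in S, f x) / volume S

/-- A weight on `ℝⁿ`: a nonnegative locally integrable function. -/
structure IsWeight {n : ℕ} (w : (Fin n → ℝ) → ℝ) : Prop where
  nonneg : ∀ x, 0 ≤ w x
  locallyIntegrable : LocallyIntegrable w volume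

/-- The non-centered Hardy-Littlewood maximal operator on the real line: the supremum of the
averages of `f` over the bounded nondegenerate intervals that contain `x`. -/
noncomputable def maximalFun (f : ℝ → ℝ≥0∞) (x : ℝ) : ℝ≥0∞ :=
  ⨆ (a : ℝ) (b : ℝ) (_ : a < b) (_ : x ∈ Set.Icc a b), avg (Set.Icc a b) f

/-- The Fujii-Wilson constant of a weight `v` on the real line,
`sup_I (1 / v(I)) ∫_I M(v 1_I)`, the supremum being over the bounded nondegenerate intervals.
If `v(I) = 0` then the integral of the maximal function vanishes too and the quotient is `0`. -/
noncomputable def aInftyConst (v : ℝ → ℝ) : ℝ≥0∞ :=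
  ⨆ (a : ℝ) (b : ℝ) (_ : a < b),
    (∫⁻ x in Set.Icc a b,
        maximalFun ((Set.Icc a b).indicator fun t => ENNReal.ofReal (v t)) x) /
      ∫⁻ x in Set.Icc a b, ENNReal.ofReal (v x)

/-- The one-dimensional slice of `w` in the `j`-th direction,
`t ↦ w (y₁, …, y_{j-1}, t, y_j, …, y_m)`, for `y ∈ ℝᵐ` and `w` a function on `ℝ^{m+1}`. -/
def slice {m : ℕ} (w : (Fin (m + 1) → ℝ) → ℝ) (j : Fin (m + 1)) (y : Fin m → ℝ) : ℝ → ℝ :=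
  fun t => w (j.insertNth t y)

/-- The strong Muckenhoupt constant `[w]_{A_∞^*}` of a weight on `ℝ^{m+1}`: the supremum over the
coordinate directions of the essential supremum of the Fujii-Wilson constants of the slices. -/
noncomputable def aInftyStarConst {m : ℕ} (w : (Fin (m + 1) → ℝ) → ℝ) : ℝ≥0∞ :=
  ⨆ j : Fin (m + 1), essSup (fun y : Fin m → ℝ => aInftyConst (slice w j y)) volume

/-- The class `A_∞^*` of strong Muckenhoupt weights on `ℝ^{m+1}`. -/
def MemAInftyStar {m : ℕ} (w : (Fin (m + 1) → ℝ) → ℝ) : Prop :=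
  IsWeight w ∧ aInftyStarConst w < ∞

/-- `w` satisfies, on every axis-parallel rectangle `R` (nondegenerate and bounded), the reverse
Hölder inequality `(⨍_R w^r)^{1/r} ≤ B ⨍_R w`. In particular `w^r` is integrable on `R` as soon
as `w` is. -/
def ReverseHolder {n : ℕ} (w : (Fin n → ℝ) → ℝ) (r B : ℝ) : Prop :=
  ∀ a b : Fin n → ℝ, (∀ i, a i < b i) →
    (avg (Set.Icc a b) fun x => ENNReal.ofReal (w x) ^ r) ^ (1 / r) ≤
      ENNReal.ofReal B * avg (Set.Icc a b) fun x => ENNReal.ofReal (w x)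

end StrongWeights

namespace StrongWeights

open Set Filter Topology

/-! For (i), fix a line, a weight `v` on it, an interval `I`, and let `M` be the maximal function of
`v 1_I`. Above the level `v_I` (the average), each component of `{M > t}` meets `I` in an interval
`J` (up to endpoints) whose average is at most `t`, and on which `M` is dominated by the maximal
function of `v 1_J`. The Fujii-Wilson condition on `J` then gives `∫_J M ≤ A t |J|`
(`setLIntegral_level_le`). Integrating these bounds against `t^(s-1)` (`lintegral_rpow_le_of_level`)
lets the moment of order `1 + s` be absorbed once `A s ≤ 1/2`, and yields a reverse Hölder
inequality with a constant free of `A` (`avg_rpow_le_of_maximalFun`). Induction on the coordinates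
with Minkowski's integral inequality multiplies the one-dimensional constants, whence `C_n = 2^n`
(`avg_rpow_le_of_slices`). With `c = 3` the admissible exponents satisfy `A (r - 1) ≤ 1/2` as soon
as `A ≥ 1`, so the factor that blows up at the endpoint enters only through being at least `1`.

For (ii), boxes shrinking to a segment and Lebesgue differentiation carry the reverse Hölder
inequality, with the same `B`, to almost every slice (`ae_slice_reverseHolder`). On the line, `∫_I
M` is an integral over levels, cut at `v_I` and at `2 B^(r') v_I`. The low levels are bounded
trivially, the middle ones by the weak type inequality, which produces the logarithm of `B`, and the
high ones by the weak type inequality on `{v > t/2}` combined with the reverse Hölder inequality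
(`lintegral_maximalFun_le_of_reverseHolder`). -/

/-! ### The maximal operator on the line and Lebesgue differentiation. -/

theorem lt_maximalFun_iff {f : ℝ → ℝ≥0∞} {x : ℝ} {l : ℝ≥0∞} :
    l < maximalFun f x ↔ ∃ a b, a < b ∧ x ∈ Icc a b ∧ l < avg (Icc a b) f := by
  simp only [maximalFun, lt_iSup_iff, exists_prop]

theorem avg_le_maximalFun {f : ℝ → ℝ≥0∞} {a b x : ℝ} (h : a < b) (hx : x ∈ Icc a b) :
    avg (Icc a b) f ≤ maximalFun f x :=
  le_iSup₂_of_le a b (le_iSup₂_of_le h hx le_rfl)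

theorem lt_avg_Icc_iff {f : ℝ → ℝ≥0∞} {a b : ℝ} (h : a < b) {l : ℝ≥0∞} :
    l < avg (Icc a b) f ↔ l * ENNReal.ofReal (b - a) < ∫⁻ x in Icc a b, f x := by
  have : ENNReal.ofReal (b - a) ≠ 0 := by simpa using h
  rw [avg, Real.volume_Icc, ENNReal.lt_div_iff_mul_lt (Or.inl this) (Or.inl ENNReal.ofReal_ne_top)]

theorem avg_Icc_le_iff {f : ℝ → ℝ≥0∞} {a b : ℝ} (h : a < b) {l : ℝ≥0∞} :
    avg (Icc a b) f ≤ l ↔ ∫⁻ x in Icc a b, f x ≤ l * ENNReal.ofReal (b - a) := by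
  rw [← not_lt, lt_avg_Icc_iff h, not_lt]

/-- An interval whose average exceeds `l` can be lengthened a little at both ends without losing
this, and the longer interval contains a neighbourhood of `x`. -/
theorem isOpen_lt_maximalFun (f : ℝ → ℝ≥0∞) (l : ℝ≥0∞) : IsOpen {x | l < maximalFun f x} := by
  rw [isOpen_iff_mem_nhds]
  intro x hx
  obtain ⟨a, b, hab, hxab, hl⟩ := lt_maximalFun_iff.1 hx
  rw [lt_avg_Icc_iff hab] at hl
  have hltop : l ≠ ∞ := by
    rintro rfl
    rw [ENNReal.top_mul (by simpa using hab)] at hl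
    exact not_top_lt hl
  have ht : Tendsto (fun d : ℝ => l * ENNReal.ofReal (b - a + 2 * d)) (𝓝[>] 0)
      (𝓝 (l * ENNReal.ofReal (b - a + 2 * 0))) := by
    refine ENNReal.Tendsto.const_mul ?_ (Or.inr hltop)
    refine (ENNReal.continuous_ofReal.comp ?_).continuousAt.tendsto.mono_left nhdsWithin_le_nhds
    fun_prop
  obtain ⟨d, hd, hd0⟩ :=
    ((ht.eventually_lt_const (by simpa using hl)).and self_mem_nhdsWithin).exists
  have hd0 : 0 < d := hd0
  filter_upwards [Ioo_mem_nhds (show a - d < x by linarith [hxab.1])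
    (show x < b + d by linarith [hxab.2])] with y hy
  refine lt_maximalFun_iff.2 ⟨a - d, b + d, by linarith, ⟨hy.1.le, hy.2.le⟩, ?_⟩
  rw [lt_avg_Icc_iff (by linarith), show b + d - (a - d) = b - a + 2 * d by ring]
  exact hd.trans_le (lintegral_mono_set (Icc_subset_Icc (by linarith) (by linarith)))

theorem measurable_maximalFun (f : ℝ → ℝ≥0∞) : Measurable (maximalFun f) :=
  measurable_of_Ioi fun l => (isOpen_lt_maximalFun f l).measurableSet

/-- The averages of a function with locally finite integral over the shrinking cubes centred at
almost every point converge to its value there. -/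
theorem ae_tendsto_avg_closedBall {n : ℕ} {f : (Fin n → ℝ) → ℝ≥0∞} (hf : AEMeasurable f volume)
    (hfin : ∀ R : ℝ, ∫⁻ x in Metric.closedBall 0 R, f x ≠ ∞) :
    ∀ᵐ x, Tendsto (fun d => avg (Metric.closedBall x d) f) (𝓝[>] 0) (𝓝 (f x)) := by
  let v := IsUnifLocDoublingMeasure.vitaliFamily (volume : Measure (Fin n → ℝ)) 1
  -- The differentiation theorem is applied to functions with finite integral, so `f` is cut off to
  -- balls of integer radius.
  have key : ∀ N : ℕ, ∀ᵐ x, Tendsto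
      (fun a => (∫⁻ y in a, (Metric.closedBall 0 (N : ℝ)).indicator f y) / volume a)
      (v.filterAt x) (𝓝 ((Metric.closedBall 0 (N : ℝ)).indicator f x)) := fun N =>
    v.ae_tendsto_lintegral_div (hf.indicator Metric.isClosed_closedBall.measurableSet) (by
      rw [lintegral_indicator Metric.isClosed_closedBall.measurableSet]
      exact hfin N)
  filter_upwards [ae_all_iff.2 key] with x hx
  obtain ⟨N, hN⟩ := exists_nat_gt (‖x‖ + 1)
  have hball : Tendsto (fun d : ℝ => Metric.closedBall x d) (𝓝[>] 0) (v.filterAt x) :=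
    IsUnifLocDoublingMeasure.tendsto_closedBall_filterAt _ (fun _ => x) (fun d => d) tendsto_id
      (by filter_upwards [self_mem_nhdsWithin] with d hd
          simpa using (le_of_lt hd : (0 : ℝ) ≤ d))
  have h := (hx N).comp hball
  rw [indicator_of_mem (by simpa using by linarith)] at h
  refine h.congr' ?_
  filter_upwards [Ioc_mem_nhdsGT (zero_lt_one (α := ℝ))] with d hd
  simp only [Function.comp, avg]
  congr 1
  refine setLIntegral_congr_fun Metric.isClosed_closedBall.measurableSet fun y hy => ?_
  refine indicator_of_mem ?_ _
  have h1 : ‖y - x‖ ≤ d := by simpa [dist_eq_norm] using hy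
  have h2 : ‖y‖ ≤ ‖y - x‖ + ‖x‖ := by simpa using norm_add_le (y - x) x
  simp only [Metric.mem_closedBall, dist_zero_right]
  linarith [hd.2]

theorem ae_le_maximalFun {f : ℝ → ℝ≥0∞} (hf : AEMeasurable f volume) (hfin : ∫⁻ x, f x ≠ ∞) :
    ∀ᵐ x, f x ≤ maximalFun f x := by
  let v := IsUnifLocDoublingMeasure.vitaliFamily (volume : Measure ℝ) 1
  filter_upwards [v.ae_tendsto_lintegral_div hf hfin] with x hx
  have hball : Tendsto (fun d : ℝ => Metric.closedBall x d) (𝓝[>] 0) (v.filterAt x) :=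
    IsUnifLocDoublingMeasure.tendsto_closedBall_filterAt _ (fun _ => x) (fun d => d) tendsto_id
      (by filter_upwards [self_mem_nhdsWithin] with d hd
          simpa using (le_of_lt hd : (0 : ℝ) ≤ d))
  refine le_of_tendsto (hx.comp hball) ?_
  filter_upwards [self_mem_nhdsWithin] with d hd
  have hd : 0 < d := hd
  simp only [Function.comp, Real.closedBall_eq_Icc]
  exact avg_le_maximalFun (by linarith) ⟨by linarith, by linarith⟩

/-! ### Level sets of the maximal function and their components. -/

/-- An open subset of the line is the disjoint union of countably many open components, so a
comparison of measures can be checked on each of them. -/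
theorem measure_le_of_ordConnectedComponent_le {ν ρ : Measure ℝ} {U : Set ℝ} (hU : IsOpen U)
    (h : ∀ x ∈ U, ν (U.ordConnectedComponent x) ≤ ρ (U.ordConnectedComponent x)) :
    ν U ≤ ρ U := by
  have hopen : ∀ x, IsOpen (U.ordConnectedComponent x) := by
    intro x
    rw [isOpen_iff_mem_nhds]
    intro y hy
    have : U.ordConnectedComponent x = U.ordConnectedComponent y := ordConnectedComponent_eq hy
    rw [this, ordConnectedComponent_mem_nhds]
    exact hU.mem_nhds (ordConnectedComponent_subset hy)
  have hdisj : (U.ordConnectedSection).PairwiseDisjoint (U.ordConnectedComponent) := by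
    intro x hx y hy hxy
    refine Set.disjoint_left.2 fun z hzx hzy => hxy ?_
    exact eq_of_mem_ordConnectedSection_of_uIcc_subset hx hy
      (mem_ordConnectedComponent_trans hzx (mem_ordConnectedComponent_comm.1 hzy))
  have hcount : (U.ordConnectedSection).Countable :=
    hdisj.countable_of_isOpen (fun x _ => hopen x)
      fun x hx => nonempty_ordConnectedComponent.2 (ordConnectedSection_subset hx)
  have hUeq : U = ⋃ x ∈ U.ordConnectedSection, U.ordConnectedComponent x := by
    refine subset_antisymm (fun x hx => ?_) (iUnion₂_subset fun x _ => ordConnectedComponent_subset)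
    exact mem_iUnion₂.2 ⟨_, ⟨⟨x, hx⟩, rfl⟩, mem_ordConnectedComponent_ordConnectedProj U ⟨x, hx⟩⟩
  conv_lhs => rw [hUeq]
  conv_rhs => rw [hUeq]
  rw [measure_biUnion hcount hdisj fun x _ => (hopen x).measurableSet,
    measure_biUnion hcount hdisj fun x _ => (hopen x).measurableSet]
  exact ENNReal.tsum_le_tsum fun x => h x (ordConnectedSection_subset x.2)

/-- Take `p` and `q` to be the infimum and supremum of the trace. An endpoint of the trace that lies
in `U` is interior to the component, so only the boundary of `[a, b]` can have stopped the trace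
there. -/
theorem ordConnectedComponent_inter_Icc {U : Set ℝ} (hU : IsOpen U) (x a b : ℝ) :
    (U.ordConnectedComponent x ∩ Icc a b).Subsingleton ∨
      ∃ p q, p < q ∧ a ≤ p ∧ q ≤ b ∧ Ioo p q ⊆ U.ordConnectedComponent x ∩ Icc a b ∧
        U.ordConnectedComponent x ∩ Icc a b ⊆ Icc p q ∧ (p ∉ U ∨ q ∉ U ∨ p = a ∧ q = b) := by
  set K := U.ordConnectedComponent x with hK
  by_cases hs : (K ∩ Icc a b).Subsingleton
  · exact Or.inl hs
  right
  rw [not_subsingleton_iff] at hs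
  obtain ⟨s, hs, t, ht, hst⟩ := hs.exists_lt
  have hbb : BddBelow (K ∩ Icc a b) := ⟨a, fun y hy => hy.2.1⟩
  have hba : BddAbove (K ∩ Icc a b) := ⟨b, fun y hy => hy.2.2⟩
  have hne : (K ∩ Icc a b).Nonempty := ⟨s, hs⟩
  have hoc : OrdConnected (K ∩ Icc a b) := OrdConnected.inter inferInstance ordConnected_Icc
  -- A limit point of the trace that belongs to `U` has a whole neighbourhood inside the component.
  have hnb : ∀ z ∈ U, z ∈ closure (K ∩ Icc a b) → ∃ d > 0, Ioo (z - d) (z + d) ⊆ K := by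
    intro z hzU hz
    obtain ⟨d, hd, hsub⟩ := Metric.isOpen_iff.1 hU z hzU
    obtain ⟨y, hy, hyz⟩ := Metric.mem_closure_iff.1 hz d hd
    rw [dist_comm] at hyz
    refine ⟨d, hd, fun u hu => ?_⟩
    rw [Real.ball_eq_Ioo] at hsub
    rw [Real.dist_eq, abs_lt] at hyz
    refine mem_ordConnectedComponent_trans hy.1 (subset_trans ?_ hsub)
    exact ordConnected_Ioo.uIcc_subset ⟨by linarith, by linarith⟩ hu
  refine ⟨sInf (K ∩ Icc a b), sSup (K ∩ Icc a b), ?_, le_csInf hne fun y hy => hy.2.1,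
    csSup_le hne fun y hy => hy.2.2, ?_, fun y hy => ⟨csInf_le hbb hy, le_csSup hba hy⟩, ?_⟩
  · exact (csInf_le hbb hs).trans_lt (hst.trans_le (le_csSup hba ht))
  · rintro y ⟨hy1, hy2⟩
    obtain ⟨u, hu, huy⟩ := exists_lt_of_csInf_lt hne hy1
    obtain ⟨w, hw, hyw⟩ := exists_lt_of_lt_csSup hne hy2
    exact hoc.out hu hw ⟨huy.le, hyw.le⟩
  · by_contra! hcon
    obtain ⟨hp, hq, hpq⟩ := hcon
    have hpa : sInf (K ∩ Icc a b) = a := by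
      refine le_antisymm (not_lt.1 fun hlt => ?_) (le_csInf hne fun y hy => hy.2.1)
      obtain ⟨d, hd, hsub⟩ := hnb _ hp (csInf_mem_closure hne hbb)
      set p := sInf (K ∩ Icc a b)
      have hps : p ≤ s := csInf_le hbb hs
      have : max a (p - d / 2) ∈ K ∩ Icc a b := by
        refine ⟨hsub ⟨lt_max_of_lt_right (by linarith), max_lt (by linarith) (by linarith)⟩,
          le_max_left _ _, max_le (hs.2.1.trans hs.2.2) (by linarith [hs.2.2])⟩
      have h2 := csInf_le hbb this
      exact absurd h2 (not_le.2 (max_lt hlt (by linarith)))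
    refine hpq hpa (le_antisymm (csSup_le hne fun y hy => hy.2.2) (not_lt.1 fun hlt => ?_))
    obtain ⟨d, hd, hsub⟩ := hnb _ hq (csSup_mem_closure hne hba)
    set q := sSup (K ∩ Icc a b)
    have hps : s ≤ q := le_csSup hba hs
    have : min b (q + d / 2) ∈ K ∩ Icc a b := by
      refine ⟨hsub ⟨lt_min (by linarith) (by linarith), min_lt_of_right_lt (by linarith)⟩,
        le_min (hs.2.1.trans hs.2.2) (by linarith [hs.2.1]), min_le_left _ _⟩
    have h2 := le_csSup hba this
    exact absurd h2 (not_le.2 (lt_min hlt (by linarith)))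

/-- The maximal function, restricted to a level set, localizes to the components of that set. -/
theorem maximalFun_le_of_component {v : ℝ → ℝ≥0∞} {a b p q x : ℝ} {l : ℝ≥0∞}
    (hx : l < maximalFun ((Icc a b).indicator v) x)
    (hsub : {y | l < maximalFun ((Icc a b).indicator v) y}.ordConnectedComponent x ∩ Icc a b ⊆
      Icc p q) :
    maximalFun ((Icc a b).indicator v) x ≤ maximalFun ((Icc p q).indicator v) x := by
  have key : ∀ s t, s < t → x ∈ Icc s t → l < avg (Icc s t) ((Icc a b).indicator v) →
      avg (Icc s t) ((Icc a b).indicator v) ≤ maximalFun ((Icc p q).indicator v) x := by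
    intro s t hst hxst hl
    refine le_trans ?_ (avg_le_maximalFun hst hxst)
    refine ENNReal.div_le_div_right (setLIntegral_mono' measurableSet_Icc fun y hy => ?_) _
    by_cases hya : y ∈ Icc a b
    · rw [indicator_of_mem hya, indicator_of_mem]
      refine hsub ⟨fun u hu => ?_, hya⟩
      have : u ∈ Icc s t := ordConnected_Icc.uIcc_subset hxst hy hu
      exact hl.trans_le (avg_le_maximalFun hst this)
    · rw [indicator_of_notMem hya]
      exact zero_le
  refine le_of_forall_lt fun c hc => ?_
  -- Testing with `max c l` guarantees that the interval found has average above `l`, hence lies in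
  -- the component of `x`.
  obtain ⟨s, t, hst, hxs, hcs⟩ := lt_maximalFun_iff.1 (max_lt hc hx)
  exact (lt_of_le_of_lt (le_max_left _ _) hcs).trans_le
    (key s t hst hxs (lt_of_le_of_lt (le_max_right _ _) hcs))

/-- If an endpoint is outside the level set, `[p, q]` itself competes in the maximal function at
that endpoint, so its average is at most `l`. If both endpoints are inside, the interval is all of
`[a, b]`. -/
theorem lintegral_component_le {v : ℝ → ℝ≥0∞} {a b p q : ℝ} {l : ℝ≥0∞} (hpq : p < q) (hap : a ≤ p)
    (hqb : q ≤ b) (hl : avg (Icc a b) v ≤ l)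
    (h : p ∉ {y | l < maximalFun ((Icc a b).indicator v) y} ∨
      q ∉ {y | l < maximalFun ((Icc a b).indicator v) y} ∨ p = a ∧ q = b) :
    ∫⁻ x in Icc p q, v x ≤ l * ENNReal.ofReal (q - p) := by
  rw [← avg_Icc_le_iff hpq]
  have hind : avg (Icc p q) v = avg (Icc p q) ((Icc a b).indicator v) := by
    simp only [avg]
    congr 1
    refine setLIntegral_congr_fun measurableSet_Icc fun y hy => ?_
    exact (indicator_of_mem (Icc_subset_Icc hap hqb hy) v).symm
  rcases h with h | h | ⟨rfl, rfl⟩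
  · rw [hind]
    exact (avg_le_maximalFun hpq ⟨le_rfl, hpq.le⟩).trans (not_lt.1 h)
  · rw [hind]
    exact (avg_le_maximalFun hpq ⟨hpq.le, le_rfl⟩).trans (not_lt.1 h)
  · exact hl

/-- On each level set of the maximal function, above the average, the mean of the weight is at most
the level, and the mean of the maximal function is at most the level times the Fujii-Wilson
constant. -/
theorem setLIntegral_level_le {v : ℝ → ℝ≥0∞} {a b : ℝ} {A l : ℝ≥0∞} (hl : avg (Icc a b) v ≤ l)
    (hA : ∀ p q, p < q → ∫⁻ x in Icc p q, maximalFun ((Icc p q).indicator v) x ≤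
      A * ∫⁻ x in Icc p q, v x) :
    (∫⁻ x in {y | l < maximalFun ((Icc a b).indicator v) y} ∩ Icc a b, v x ≤
        l * volume ({y | l < maximalFun ((Icc a b).indicator v) y} ∩ Icc a b)) ∧
      ∫⁻ x in {y | l < maximalFun ((Icc a b).indicator v) y} ∩ Icc a b,
          maximalFun ((Icc a b).indicator v) x ≤
        A * l * volume ({y | l < maximalFun ((Icc a b).indicator v) y} ∩ Icc a b) := by
  set U := {y | l < maximalFun ((Icc a b).indicator v) y} with hUdef
  have hU : IsOpen U := isOpen_lt_maximalFun _ l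
  have hUm := hU.measurableSet
  -- Both estimates have the form `∫ g ≤ k · volume`, so they reduce to single components.
  have main : ∀ (g : ℝ → ℝ≥0∞) (k : ℝ≥0∞),
      (∀ x ∈ U, ∫⁻ y in U.ordConnectedComponent x ∩ Icc a b, g y ≤
        k * volume (U.ordConnectedComponent x ∩ Icc a b)) →
      ∫⁻ y in U ∩ Icc a b, g y ≤ k * volume (U ∩ Icc a b) := by
    intro g k hg
    have hm : ∀ x, MeasurableSet (U.ordConnectedComponent x) :=
      fun x => (inferInstance : OrdConnected (U.ordConnectedComponent x)).measurableSet
    have := measure_le_of_ordConnectedComponent_le (ν := (volume.restrict (Icc a b)).withDensity g)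
      (ρ := k • volume.restrict (Icc a b)) hU (fun x hx => by
        rw [withDensity_apply _ (hm x), Measure.restrict_restrict (hm x), Measure.smul_apply,
          Measure.restrict_apply (hm x), smul_eq_mul]
        exact hg x hx)
    rwa [withDensity_apply _ hUm, Measure.restrict_restrict hUm, Measure.smul_apply,
      Measure.restrict_apply hUm, smul_eq_mul] at this
  have comp : ∀ x ∈ U, (volume (U.ordConnectedComponent x ∩ Icc a b) = 0) ∨
      ∃ p q, p < q ∧ U.ordConnectedComponent x ∩ Icc a b ⊆ Icc p q ∧
        volume (U.ordConnectedComponent x ∩ Icc a b) = ENNReal.ofReal (q - p) ∧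
        ∫⁻ x in Icc p q, v x ≤ l * ENNReal.ofReal (q - p) := by
    intro x hx
    rcases ordConnectedComponent_inter_Icc hU x a b with h | ⟨p, q, hpq, hap, hqb, h1, h2, h3⟩
    · exact Or.inl (h.measure_zero _)
    · refine Or.inr ⟨p, q, hpq, h2, le_antisymm ?_ ?_, lintegral_component_le hpq hap hqb hl h3⟩
      · exact (measure_mono h2).trans_eq Real.volume_Icc
      · exact Real.volume_Ioo.symm.trans_le (measure_mono h1)
  constructor
  · refine main v l fun x hx => ?_
    rcases comp x hx with h | ⟨p, q, hpq, h2, hvol, h3⟩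
    · rw [Measure.restrict_eq_zero.2 h, lintegral_zero_measure]
      exact zero_le
    · rw [hvol]
      exact (lintegral_mono_set h2).trans h3
  · refine main _ _ fun x hx => ?_
    rcases comp x hx with h | ⟨p, q, hpq, h2, hvol, h3⟩
    · rw [Measure.restrict_eq_zero.2 h, lintegral_zero_measure]
      exact zero_le
    · rw [hvol]
      have hm : MeasurableSet (U.ordConnectedComponent x ∩ Icc a b) :=
        (inferInstance : OrdConnected (U.ordConnectedComponent x)).measurableSet.inter
          measurableSet_Icc
      calc ∫⁻ y in U.ordConnectedComponent x ∩ Icc a b, maximalFun ((Icc a b).indicator v) y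
          ≤ ∫⁻ y in U.ordConnectedComponent x ∩ Icc a b, maximalFun ((Icc p q).indicator v) y := by
            refine setLIntegral_mono' hm fun y hy => ?_
            have hyU : y ∈ U := ordConnectedComponent_subset hy.1
            refine maximalFun_le_of_component (l := l) hyU ?_
            rwa [← hUdef, ← ordConnectedComponent_eq hy.1]
        _ ≤ ∫⁻ y in Icc p q, maximalFun ((Icc p q).indicator v) y := lintegral_mono_set h2
        _ ≤ A * ∫⁻ y in Icc p q, v y := hA p q hpq
        _ ≤ A * l * ENNReal.ofReal (q - p) := by
            rw [mul_assoc]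
            exact mul_le_mul_right h3 A

/-! ### Layer cake and the one-dimensional reverse Hölder inequality. -/

theorem lintegral_rpow_eq_layercake {α : Type*} [MeasurableSpace α] (μ : Measure α)
    {g : α → ℝ≥0∞} (hg : Measurable g) {N : ℝ≥0∞} (hN : N ≠ ∞) (hgN : ∀ x, g x ≤ N) {s : ℝ}
    (hs : 0 < s) :
    ∫⁻ x, g x ^ s ∂μ =
      ENNReal.ofReal s *
        ∫⁻ t in Ioi (0 : ℝ), μ {x | ENNReal.ofReal t < g x} * ENNReal.ofReal (t ^ (s - 1)) := by
  have hfin : ∀ x, g x ≠ ∞ := fun x => ne_top_of_le_ne_top hN (hgN x)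
  have h := lintegral_rpow_eq_lintegral_meas_lt_mul μ (f := fun x => (g x).toReal)
    (Eventually.of_forall fun x => ENNReal.toReal_nonneg) hg.ennreal_toReal.aemeasurable hs
  have h1 : ∀ x, ENNReal.ofReal ((g x).toReal ^ s) = g x ^ s := fun x => by
    rw [← ENNReal.ofReal_rpow_of_nonneg ENNReal.toReal_nonneg hs.le, ENNReal.ofReal_toReal (hfin x)]
  simp_rw [h1] at h
  rw [h]
  congr 1
  refine setLIntegral_congr_fun measurableSet_Ioi fun t ht => ?_
  congr 3
  ext x
  exact (ENNReal.ofReal_lt_iff_lt_toReal (le_of_lt ht) (hfin x)).symm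

/-- If the level sets of `g` above the level `a₀` satisfy `μ {t < g} ≤ k t ν {t < g}`, then the
moment of order `s` of `g` with respect to `μ` is controlled by that of order `1 + s` with respect
to `ν`. -/
theorem lintegral_rpow_le_of_level {α : Type*} [MeasurableSpace α] (μ ν : Measure α)
    {g : α → ℝ≥0∞} (hg : Measurable g) {N : ℝ≥0∞} (hN : N ≠ ∞) (hgN : ∀ x, g x ≤ N) {s : ℝ}
    (hs : 0 < s) {a₀ k : ℝ≥0∞}
    (h : ∀ t : ℝ, 0 < t → a₀ ≤ ENNReal.ofReal t → μ {x | ENNReal.ofReal t < g x} ≤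
      k * ENNReal.ofReal t * ν {x | ENNReal.ofReal t < g x}) :
    ∫⁻ x, g x ^ s ∂μ ≤
      a₀ ^ s * μ univ + k * ENNReal.ofReal s * ∫⁻ x, g x ^ (1 + s) ∂ν := by
  have hmono : ∀ (ρ : Measure α) (g : α → ℝ≥0∞),
      Measurable fun t : ℝ => ρ {x | ENNReal.ofReal t < g x} := by
    intro ρ g
    refine Antitone.measurable fun t u htu => measure_mono fun x hx => ?_
    exact lt_of_le_of_lt (ENNReal.ofReal_le_ofReal htu) hx
  -- The levels below `a₀`, where nothing is assumed, are exactly those seen by `min g a₀`.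
  have hmin : ∫⁻ x, min (g x) a₀ ^ s ∂μ ≤ a₀ ^ s * μ univ := by
    rw [← lintegral_const]
    exact lintegral_mono fun x => ENNReal.rpow_le_rpow (min_le_right _ _) hs.le
  have hle : ∫⁻ x, g x ^ s ∂μ ≤ ∫⁻ x, min (g x) a₀ ^ s ∂μ + k * ENNReal.ofReal s *
      ∫⁻ t in Ioi (0 : ℝ), ν {x | ENNReal.ofReal t < g x} * ENNReal.ofReal (t ^ (1 + s - 1)) := by
    rw [lintegral_rpow_eq_layercake μ hg hN hgN hs,
      lintegral_rpow_eq_layercake μ (hg.min measurable_const) hN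
        (fun x => (min_le_left _ _).trans (hgN x)) hs, mul_comm k, mul_assoc, ← mul_add]
    have hm2 : Measurable fun t : ℝ =>
        ν {x | ENNReal.ofReal t < g x} * ENNReal.ofReal (t ^ (1 + s - 1)) :=
      (hmono ν g).mul (by fun_prop)
    rw [← lintegral_const_mul k hm2, ← lintegral_add_right _ (hm2.const_mul k)]
    refine mul_le_mul_right (setLIntegral_mono' measurableSet_Ioi fun t ht => ?_) _
    have ht : 0 < t := ht
    rcases lt_or_ge (ENNReal.ofReal t) a₀ with hta | hta
    · refine le_add_right (mul_le_mul_left (measure_mono fun x hx => ?_) _)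
      exact lt_min hx hta
    · refine le_add_left ?_
      calc μ {x | ENNReal.ofReal t < g x} * ENNReal.ofReal (t ^ (s - 1))
          ≤ (k * ENNReal.ofReal t * ν {x | ENNReal.ofReal t < g x}) *
              ENNReal.ofReal (t ^ (s - 1)) := mul_le_mul_left (h t ht hta) _
        _ = k * (ν {x | ENNReal.ofReal t < g x} * ENNReal.ofReal (t ^ (1 + s - 1))) := by
            rw [show t ^ (1 + s - 1) = t * t ^ (s - 1) by
              rw [add_sub_assoc, Real.rpow_add ht, Real.rpow_one], ENNReal.ofReal_mul ht.le]
            ring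
  refine hle.trans (add_le_add hmin (mul_le_mul_right ?_ _))
  rw [lintegral_rpow_eq_layercake ν hg hN hgN (by linarith : 0 < 1 + s)]
  -- The layer-cake formula of order `1 + s` carries a factor `1 + s ≥ 1`, which is given away.
  refine le_mul_of_one_le_left zero_le ?_
  rw [ENNReal.one_le_ofReal]
  linarith

/-- The one-dimensional reverse Hölder inequality. -/
theorem avg_rpow_le_of_maximalFun {v : ℝ → ℝ≥0∞} (hv : AEMeasurable v volume) {A : ℝ}
    (hA0 : 0 ≤ A)
    (hA : ∀ p q, p < q → ∫⁻ x in Icc p q, maximalFun ((Icc p q).indicator v) x ≤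
      ENNReal.ofReal A * ∫⁻ x in Icc p q, v x)
    {s : ℝ} (hs : 0 < s) (hAs : A * s ≤ 1 / 2) {a b : ℝ} (hab : a < b)
    (hfin : ∫⁻ x in Icc a b, v x ≠ ∞) :
    avg (Icc a b) (fun x => v x ^ (1 + s)) ≤ 2 * avg (Icc a b) v ^ (1 + s) := by
  set M := maximalFun ((Icc a b).indicator v) with hM
  set V := ∫⁻ x in Icc a b, v x with hV
  set a₀ := avg (Icc a b) v with ha₀
  have hvol0 : volume (Icc a b) ≠ 0 := by simpa using hab
  have hvolt : volume (Icc a b) ≠ ∞ := by simp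
  have hMm : Measurable M := measurable_maximalFun _
  have ha₀V : a₀ * volume (Icc a b) = V := ENNReal.div_mul_cancel hvol0 hvolt
  have ha₀t : a₀ ≠ ∞ := ENNReal.div_ne_top hfin hvol0
  have hMV : ∫⁻ x in Icc a b, M x ≤ ENNReal.ofReal A * V := hA a b hab
  have hae : ∀ᵐ x ∂volume.restrict (Icc a b), v x ≤ M x := by
    rw [ae_restrict_iff' measurableSet_Icc]
    filter_upwards [ae_le_maximalFun (hv.indicator measurableSet_Icc) (by
      rwa [lintegral_indicator measurableSet_Icc])] with x hx hxI
    rwa [indicator_of_mem hxI] at hx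
  have hvt : ∀ᵐ x ∂volume.restrict (Icc a b), v x < ∞ :=
    ae_lt_top' hv.restrict hfin
  -- the truncated estimate
  have key : ∀ N : ℕ, ∫⁻ x in Icc a b, min (v x) N ^ s * v x ≤ 2 * (a₀ ^ s * V) := by
    intro N
    set g : ℝ → ℝ≥0∞ := fun x => min (M x) N with hg
    have hgm : Measurable g := hMm.min measurable_const
    have hgN : ∀ x, g x ≤ (N : ℝ≥0∞) := fun x => min_le_right _ _
    have hNt : (N : ℝ≥0∞) ≠ ∞ := ENNReal.natCast_ne_top N
    -- Truncation at `N` leaves the level sets below `N` unchanged and empties the others.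
    have hlev : ∀ t : ℝ, {x | ENNReal.ofReal t < g x} = {x | ENNReal.ofReal t < M x} ∨
        {x | ENNReal.ofReal t < g x} = ∅ := by
      intro t
      by_cases htN : ENNReal.ofReal t < N
      · left; ext x; simp [hg, htN]
      · right; ext x; simp [hg, htN]
    have hmo : ∀ t : ℝ, MeasurableSet {x | ENNReal.ofReal t < M x} :=
      fun t => (isOpen_lt_maximalFun _ _).measurableSet
    -- The level bounds are used twice: with density `M` and constant `A`, then with density `v` and
    -- constant `1`.
    have hX := lintegral_rpow_le_of_level ((volume.restrict (Icc a b)).withDensity M)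
      (volume.restrict (Icc a b)) hgm hNt hgN hs (a₀ := a₀) (k := ENNReal.ofReal A) (by
        intro t ht hat
        rcases hlev t with h | h
        · rw [h, withDensity_apply _ (hmo t), Measure.restrict_restrict (hmo t),
            Measure.restrict_apply (hmo t)]
          exact (setLIntegral_level_le hat hA).2
        · simp [h])
    have hY := lintegral_rpow_le_of_level ((volume.restrict (Icc a b)).withDensity v)
      (volume.restrict (Icc a b)) hgm hNt hgN hs (a₀ := a₀) (k := 1) (by
        intro t ht hat
        rcases hlev t with h | h
        · rw [h, withDensity_apply _ (hmo t), Measure.restrict_restrict (hmo t),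
            Measure.restrict_apply (hmo t), one_mul]
          exact (setLIntegral_level_le hat hA).1
        · simp [h])
    have hgs : Measurable fun x => g x ^ s := hgm.pow_const s
    rw [lintegral_withDensity_eq_lintegral_mul _ hMm hgs, withDensity_apply _ MeasurableSet.univ,
      Measure.restrict_univ] at hX
    rw [lintegral_withDensity_eq_lintegral_mul₀ hv.restrict hgs.aemeasurable,
      withDensity_apply _ MeasurableSet.univ, Measure.restrict_univ, one_mul, ← hV] at hY
    simp only [Pi.mul_apply] at hX hY
    set X := ∫⁻ x in Icc a b, M x * g x ^ s with hXdef
    have hZ : ∫⁻ x in Icc a b, g x ^ (1 + s) ≤ X := by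
      refine lintegral_mono fun x => ?_
      simp only
      rw [ENNReal.rpow_add_of_nonneg _ _ zero_le_one hs.le, ENNReal.rpow_one]
      exact mul_le_mul_left (min_le_left _ _) _
    have hXt : X ≠ ∞ := by
      have : X ≤ ∫⁻ x in Icc a b, M x * (N : ℝ≥0∞) ^ s :=
        lintegral_mono fun x => mul_le_mul_right (ENNReal.rpow_le_rpow (hgN x) hs.le) _
      rw [lintegral_mul_const _ hMm] at this
      refine ne_top_of_le_ne_top (ENNReal.mul_ne_top ?_ ?_) this
      · exact ne_top_of_le_ne_top (ENNReal.mul_ne_top ENNReal.ofReal_ne_top hfin) hMV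
      · exact ENNReal.rpow_ne_top_of_nonneg hs.le hNt
    have ha0s : a₀ ^ s ≠ ∞ := ENNReal.rpow_ne_top_of_nonneg hs.le ha₀t
    have hX1 : X ≤ ENNReal.ofReal A * (a₀ ^ s * V) + ENNReal.ofReal (A * s) * X := by
      calc X ≤ _ := hX
        _ ≤ a₀ ^ s * (ENNReal.ofReal A * V) + ENNReal.ofReal A * ENNReal.ofReal s * X :=
          add_le_add (mul_le_mul_right hMV _) (mul_le_mul_right hZ _)
        _ = _ := by rw [ENNReal.ofReal_mul hA0]; ring
    have hP : a₀ ^ s * V ≠ ∞ := ENNReal.mul_ne_top ha0s hfin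
    -- Absorption with `A s ≤ 1/2` gives `X ≤ 2 A a₀^s V`; the extra factor `s` cancels the
    -- dependence on `A`. The finiteness of `X`, secured by the truncation, is essential.
    have hX2 : ENNReal.ofReal s * X ≤ a₀ ^ s * V := by
      lift X to NNReal using hXt with X' 
      set P := a₀ ^ s * V with hPdef
      lift P to NNReal using hP with P'
      have h1 := ENNReal.toReal_mono (by finiteness) hX1
      rw [ENNReal.toReal_add (by finiteness) (by finiteness), ENNReal.toReal_mul,
        ENNReal.toReal_mul, ENNReal.toReal_ofReal hA0, ENNReal.toReal_ofReal (by positivity)] at h1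
      simp only [ENNReal.coe_toReal] at h1
      have hX0 : (0 : ℝ) ≤ X' := X'.2
      have hP0 : (0 : ℝ) ≤ P' := P'.2
      have h2 : (X' : ℝ) ≤ 2 * (A * P') := by
        nlinarith [mul_le_mul_of_nonneg_right hAs hX0]
      have h3 : s * X' ≤ P' := by
        nlinarith [mul_le_mul_of_nonneg_left h2 hs.le, mul_le_mul_of_nonneg_right hAs hP0]
      have h4 : (s * X' : ℝ) = (ENNReal.ofReal s * (X' : ℝ≥0∞)).toReal := by
        rw [ENNReal.toReal_mul, ENNReal.toReal_ofReal hs.le, ENNReal.coe_toReal]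
      rw [h4, ← ENNReal.coe_toReal, ENNReal.toReal_le_toReal (by finiteness) (by finiteness)] at h3
      exact h3
    calc ∫⁻ x in Icc a b, min (v x) N ^ s * v x
        ≤ ∫⁻ x in Icc a b, v x * g x ^ s := by
          refine lintegral_mono_ae ?_
          filter_upwards [hae] with x hx
          rw [mul_comm]
          exact mul_le_mul_right (ENNReal.rpow_le_rpow (min_le_min_right _ hx) hs.le) _
      _ ≤ _ := hY
      _ ≤ a₀ ^ s * V + a₀ ^ s * V :=
          add_le_add le_rfl ((mul_le_mul_right hZ _).trans hX2)
      _ = _ := by ring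
  have hlim : ∫⁻ x in Icc a b, v x ^ s * v x ≤ 2 * (a₀ ^ s * V) := by
    refine le_of_tendsto' (lintegral_tendsto_of_tendsto_of_monotone
      (f := fun (N : ℕ) x => min (v x) N ^ s * v x) (fun N => ?_) ?_ ?_) key
    · exact ((hv.restrict.min aemeasurable_const).pow_const s).mul hv.restrict
    · refine ae_of_all _ fun x N N' hNN' => mul_le_mul_left (ENNReal.rpow_le_rpow ?_ hs.le) _
      exact min_le_min_left _ (by exact_mod_cast hNN')
    · filter_upwards [hvt] with x hx
      refine ENNReal.Tendsto.mul_const ?_ (Or.inr hx.ne)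
      refine (ENNReal.continuous_rpow_const.tendsto _).comp ?_
      simpa using (tendsto_const_nhds (x := v x)).min ENNReal.tendsto_nat_nhds_top
  have hpow : ∀ y : ℝ≥0∞, y ^ (1 + s) = y ^ s * y := fun y => by
    rw [add_comm, ENNReal.rpow_add_of_nonneg _ _ hs.le zero_le_one, ENNReal.rpow_one]
  unfold avg
  simp_rw [hpow]
  rw [ENNReal.div_le_iff hvol0 hvolt]
  refine hlim.trans_eq ?_
  rw [← ha₀V]
  ring

/-! ### Minkowski's inequality, averages and Fubini on rectangles. -/

/-- Minkowski's integral inequality. -/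
theorem lintegral_rpow_lintegral_le {α β : Type*} [MeasurableSpace α] [MeasurableSpace β]
    (μ : Measure α) (ν : Measure β) [IsFiniteMeasure μ] [SFinite ν] {F : α → β → ℝ≥0∞}
    (hF : Measurable (Function.uncurry F)) {r : ℝ} (hr : 1 < r) :
    (∫⁻ x, (∫⁻ y, F x y ∂ν) ^ r ∂μ) ^ (1 / r) ≤ ∫⁻ y, (∫⁻ x, F x y ^ r ∂μ) ^ (1 / r) ∂ν := by
  have hr0 : 0 < r := by linarith
  set H : α → ℝ≥0∞ := fun x => ∫⁻ y, F x y ∂ν with hH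
  set S := ∫⁻ y, (∫⁻ x, F x y ^ r ∂μ) ^ (1 / r) ∂ν with hS
  have hHm : Measurable H := hF.lintegral_prod_right'
  have hconj : (r / (r - 1)).HolderConjugate r := (Real.HolderConjugate.conjExponent hr).symm
  have key : ∀ N : ℕ, ∫⁻ x, min (H x) N ^ r ∂μ ≤ S ^ r := by
    intro N
    -- Truncation makes `P` finite, so that after Hölder's inequality a power of `P` can be
    -- cancelled.
    set G : α → ℝ≥0∞ := fun x => min (H x) N with hG
    have hGm : Measurable G := hHm.min measurable_const
    set P := ∫⁻ x, G x ^ r ∂μ with hP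
    have hPt : P ≠ ∞ := by
      refine ne_top_of_le_ne_top ?_ (lintegral_mono (g := fun _ => (N : ℝ≥0∞) ^ r)
        fun x => ENNReal.rpow_le_rpow (min_le_right _ _) hr0.le)
      rw [lintegral_const]
      exact ENNReal.mul_ne_top (ENNReal.rpow_ne_top_of_nonneg hr0.le (ENNReal.natCast_ne_top N))
        (measure_ne_top _ _)
    have h1 : P ≤ P ^ (1 / (r / (r - 1))) * S := by
      calc P ≤ ∫⁻ x, G x ^ (r - 1) * H x ∂μ := by
            refine lintegral_mono fun x => ?_
            simp only
            conv_lhs => rw [show r = (r - 1) + 1 by ring,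
              ENNReal.rpow_add_of_nonneg _ _ (by linarith) zero_le_one, ENNReal.rpow_one]
            exact mul_le_mul_right (min_le_left _ _) _
        _ = ∫⁻ x, ∫⁻ y, G x ^ (r - 1) * F x y ∂ν ∂μ := by
            refine lintegral_congr fun x => ?_
            rw [lintegral_const_mul _ hF.of_uncurry_left]
        _ = ∫⁻ y, ∫⁻ x, G x ^ (r - 1) * F x y ∂μ ∂ν := by
            refine lintegral_lintegral_swap ?_
            exact (((hGm.pow_const _).comp measurable_fst).mul hF).aemeasurable
        _ ≤ ∫⁻ y, P ^ (1 / (r / (r - 1))) * (∫⁻ x, F x y ^ r ∂μ) ^ (1 / r) ∂ν := by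
            refine lintegral_mono fun y => ?_
            refine (ENNReal.lintegral_mul_le_Lp_mul_Lq μ hconj (hGm.pow_const _).aemeasurable
              hF.of_uncurry_right.aemeasurable).trans_eq ?_
            congr 3
            refine funext fun x => ?_
            rw [← ENNReal.rpow_mul, mul_div_cancel₀ _ (by linarith : r - 1 ≠ 0)]
        _ = P ^ (1 / (r / (r - 1))) * S := by
            refine lintegral_const_mul _ (Measurable.pow_const ?_ _)
            exact (hF.pow_const r).lintegral_prod_left'
    rcases eq_or_ne P 0 with hP0 | hP0
    · rw [hP0]; exact zero_le
    have hq : 0 ≤ 1 / (r / (r - 1)) := by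
      have : 0 < r - 1 := by linarith
      positivity
    have hne0 : P ^ (1 / (r / (r - 1))) ≠ 0 := by
      rw [Ne, ENNReal.rpow_eq_zero_iff]
      rintro (⟨h, -⟩ | ⟨h, -⟩)
      exacts [hP0 h, hPt h]
    have hnet : P ^ (1 / (r / (r - 1))) ≠ ∞ := ENNReal.rpow_ne_top_of_nonneg hq hPt
    have h2 : P ^ (1 / r) ≤ S := by
      rw [← ENNReal.mul_le_mul_iff_right hne0 hnet, ← ENNReal.rpow_add _ _ hP0 hPt]
      refine le_trans (le_of_eq ?_) h1
      have : 1 / (r / (r - 1)) + 1 / r = 1 := by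
        field_simp
        ring
      rw [this, ENNReal.rpow_one]
    calc P = (P ^ (1 / r)) ^ r := by
          rw [← ENNReal.rpow_mul, one_div_mul_cancel hr0.ne', ENNReal.rpow_one]
      _ ≤ S ^ r := ENNReal.rpow_le_rpow h2 hr0.le
  have hlim : ∫⁻ x, H x ^ r ∂μ ≤ S ^ r := by
    refine le_of_tendsto' (lintegral_tendsto_of_tendsto_of_monotone
      (f := fun (N : ℕ) x => min (H x) N ^ r) (fun N => ?_) ?_ ?_) key
    · exact ((hHm.min measurable_const).pow_const r).aemeasurable
    · refine ae_of_all _ fun x N N' hNN' => ENNReal.rpow_le_rpow ?_ hr0.le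
      exact min_le_min_left _ (by exact_mod_cast hNN')
    · refine ae_of_all _ fun x => ?_
      refine (ENNReal.continuous_rpow_const.tendsto _).comp ?_
      simpa using (tendsto_const_nhds (x := H x)).min ENNReal.tendsto_nat_nhds_top
  calc (∫⁻ x, H x ^ r ∂μ) ^ (1 / r) ≤ (S ^ r) ^ (1 / r) :=
        ENNReal.rpow_le_rpow hlim (by positivity)
    _ = S := by rw [← ENNReal.rpow_mul, mul_one_div_cancel hr0.ne', ENNReal.rpow_one]

theorem avg_eq_lintegral {X : Type*} [MeasureSpace X] (S : Set X) (f : X → ℝ≥0∞) :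
    avg S f = ∫⁻ x, f x ∂((volume S)⁻¹ • volume.restrict S) := by
  rw [lintegral_smul_measure, avg, ENNReal.div_eq_inv_mul, smul_eq_mul]

theorem avg_mono_ae {X : Type*} [MeasureSpace X] {S : Set X} {f g : X → ℝ≥0∞}
    (h : ∀ᵐ x, f x ≤ g x) : avg S f ≤ avg S g :=
  ENNReal.div_le_div_right (lintegral_mono_ae (ae_restrict_of_ae h)) _

theorem avg_congr_ae {X : Type*} [MeasureSpace X] {S : Set X} {f g : X → ℝ≥0∞}
    (h : ∀ᵐ x, f x = g x) : avg S f = avg S g :=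
  le_antisymm (avg_mono_ae (h.mono fun _ => le_of_eq)) (avg_mono_ae (h.mono fun _ => ge_of_eq))

theorem avg_const_mul {X : Type*} [MeasureSpace X] (S : Set X) (f : X → ℝ≥0∞) {c : ℝ≥0∞}
    (hc : c ≠ ∞) : avg S (fun x => c * f x) = c * avg S f := by
  rw [avg, lintegral_const_mul' _ _ hc, mul_div_assoc, avg]

theorem volume_Icc_pi_ne_zero {n : ℕ} {a b : Fin n → ℝ} (h : ∀ i, a i < b i) :
    volume (Icc a b) ≠ 0 := by
  rw [Real.volume_Icc_pi, Finset.prod_ne_zero_iff]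
  intro i _
  simpa using h i

theorem volume_Icc_pi_ne_top {n : ℕ} (a b : Fin n → ℝ) : volume (Icc a b) ≠ ∞ :=
  isCompact_Icc.measure_lt_top.ne

theorem avg_rpow_avg_le {n : ℕ} {a b : ℝ} (hab : a < b) {p q : Fin n → ℝ}
    (hpq : ∀ i, p i < q i) {F : ℝ → (Fin n → ℝ) → ℝ≥0∞} (hF : Measurable (Function.uncurry F))
    {r : ℝ} (hr : 1 < r) :
    (avg (Icc a b) fun t => (avg (Icc p q) fun y => F t y) ^ r) ^ (1 / r) ≤
      avg (Icc p q) fun y => (avg (Icc a b) fun t => F t y ^ r) ^ (1 / r) := by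
  have h1 : (volume (Icc a b))⁻¹ ≠ ∞ := by simpa using hab
  have h2 : (volume (Icc p q))⁻¹ ≠ ∞ := ENNReal.inv_ne_top.2 (volume_Icc_pi_ne_zero hpq)
  have : IsFiniteMeasure ((volume (Icc a b))⁻¹ • (volume : Measure ℝ).restrict (Icc a b)) :=
    Measure.smul_finite _ h1
  have : IsFiniteMeasure
      ((volume (Icc p q))⁻¹ • (volume : Measure (Fin n → ℝ)).restrict (Icc p q)) := by
    have : IsFiniteMeasure ((volume : Measure (Fin n → ℝ)).restrict (Icc p q)) :=
      ⟨by simpa using (volume_Icc_pi_ne_top p q).lt_top⟩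
    exact Measure.smul_finite _ h2
  simp only [avg_eq_lintegral]
  exact lintegral_rpow_lintegral_le _ _ hF hr

theorem ae_prod_insertNth {n : ℕ} (j : Fin (n + 1)) {P : (Fin (n + 1) → ℝ) → Prop}
    (h : ∀ᵐ x, P x) : ∀ᵐ z : ℝ × (Fin n → ℝ), P (j.insertNth z.1 z.2) :=
  (volume_preserving_piFinSuccAbove (fun _ : Fin (n + 1) => ℝ) j).symm.quasiMeasurePreserving.ae h

theorem ae_ae_insertNth {n : ℕ} (j : Fin (n + 1)) {P : (Fin (n + 1) → ℝ) → Prop}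
    (h : ∀ᵐ x, P x) : ∀ᵐ t : ℝ, ∀ᵐ y : Fin n → ℝ, P (j.insertNth t y) :=
  Measure.ae_ae_of_ae_prod (ae_prod_insertNth j h)

theorem ae_ae_insertNth' {n : ℕ} (j : Fin (n + 1)) {P : (Fin (n + 1) → ℝ) → Prop}
    (h : ∀ᵐ x, P x) : ∀ᵐ y : Fin n → ℝ, ∀ᵐ t : ℝ, P (j.insertNth t y) :=
  Measure.ae_ae_of_ae_prod (p := fun z : (Fin n → ℝ) × ℝ => P (j.insertNth z.2 z.1))
    (Measure.measurePreserving_swap.quasiMeasurePreserving.ae (ae_prod_insertNth j h))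

theorem ae_removeNth {n : ℕ} (j : Fin (n + 1)) {P : (Fin n → ℝ) → Prop}
    (h : ∀ᵐ y, P y) : ∀ᵐ x : Fin (n + 1) → ℝ, P (j.removeNth x) :=
  (Measure.quasiMeasurePreserving_snd.comp (volume_preserving_piFinSuccAbove
    (fun _ : Fin (n + 1) => ℝ) j).quasiMeasurePreserving).ae h

theorem measurable_insertNth {n : ℕ} (j : Fin (n + 1)) :
    Measurable fun z : ℝ × (Fin n → ℝ) => (j.insertNth z.1 z.2 : Fin (n + 1) → ℝ) :=
  (MeasurableEquiv.piFinSuccAbove (fun _ : Fin (n + 1) => ℝ) j).symm.measurable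

theorem setLIntegral_Icc_insertNth {n : ℕ} (j : Fin (n + 1)) (a b : Fin (n + 1) → ℝ)
    (f : (Fin (n + 1) → ℝ) → ℝ≥0∞) :
    ∫⁻ x in Icc a b, f x = ∫⁻ z, f (j.insertNth z.1 z.2)
      ∂((volume.restrict (Icc (a j) (b j))).prod
        (volume.restrict (Icc (j.removeNth a) (j.removeNth b)))) := by
  have hmp := (volume_preserving_piFinSuccAbove (fun _ : Fin (n + 1) => ℝ) j).symm
  rw [← hmp.setLIntegral_comp_preimage_emb (MeasurableEquiv.measurableEmbedding _),
    Measure.prod_restrict]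
  congr 2
  ext z
  exact Fin.insertNth_mem_Icc

theorem volume_Icc_insertNth {n : ℕ} (j : Fin (n + 1)) (a b : Fin (n + 1) → ℝ) :
    volume (Icc a b) = volume (Icc (a j) (b j)) *
      volume (Icc (j.removeNth a) (j.removeNth b)) := by
  have := setLIntegral_Icc_insertNth j a b 1
  simpa [← Set.univ_prod_univ, Measure.prod_prod] using this

theorem avg_Icc_insertNth {n : ℕ} (j : Fin (n + 1)) {a b : Fin (n + 1) → ℝ}
    (hab : ∀ i, a i < b i) {f : (Fin (n + 1) → ℝ) → ℝ≥0∞} (hf : Measurable f) :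
    avg (Icc a b) f = avg (Icc (a j) (b j)) fun t =>
      avg (Icc (j.removeNth a) (j.removeNth b)) fun y => f (j.insertNth t y) := by
  have h2 : volume (Icc (j.removeNth a) (j.removeNth b)) ≠ 0 :=
    volume_Icc_pi_ne_zero fun i => hab _
  have h1 : volume (Icc (a j) (b j)) ≠ 0 := by simpa using hab j
  have hm : Measurable fun z : ℝ × (Fin n → ℝ) => f (j.insertNth z.1 z.2) :=
    hf.comp (measurable_insertNth j)
  simp only [avg, div_eq_mul_inv]
  rw [setLIntegral_Icc_insertNth j, lintegral_prod _ hm.aemeasurable,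
    volume_Icc_insertNth j, lintegral_mul_const' _ _ (ENNReal.inv_ne_top.2 h2),
    ENNReal.mul_inv (Or.inl h1) (Or.inr h2), mul_assoc, mul_comm (volume (Icc (a j) (b j)))⁻¹]

theorem avg_Icc_insertNth' {n : ℕ} (j : Fin (n + 1)) {a b : Fin (n + 1) → ℝ}
    (hab : ∀ i, a i < b i) {f : (Fin (n + 1) → ℝ) → ℝ≥0∞} (hf : Measurable f) :
    avg (Icc a b) f = avg (Icc (j.removeNth a) (j.removeNth b)) fun y =>
      avg (Icc (a j) (b j)) fun t => f (j.insertNth t y) := by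
  have h2 : volume (Icc (j.removeNth a) (j.removeNth b)) ≠ 0 :=
    volume_Icc_pi_ne_zero fun i => hab _
  have h1 : volume (Icc (a j) (b j)) ≠ 0 := by simpa using hab j
  have hm : Measurable fun z : ℝ × (Fin n → ℝ) => f (j.insertNth z.1 z.2) :=
    hf.comp (measurable_insertNth j)
  simp only [avg, div_eq_mul_inv]
  rw [setLIntegral_Icc_insertNth j,
    lintegral_prod_symm _ hm.aemeasurable,
    volume_Icc_insertNth j, lintegral_mul_const' _ _ (ENNReal.inv_ne_top.2 h1),
    ENNReal.mul_inv (Or.inl h1) (Or.inr h2), mul_assoc]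

/-! ### From slices to rectangles. -/

/-- A function whose slices in every coordinate direction satisfy a reverse Hölder inequality
satisfies one on rectangles. -/
theorem avg_rpow_le_of_slices {r : ℝ} (hr : 1 < r) {D : ℝ≥0∞} (hD : D ≠ ∞) (n : ℕ) :
    ∀ f : (Fin n → ℝ) → ℝ≥0∞, Measurable f →
      (∀ j, ∀ᵐ x, ∀ a b, a < b → (avg (Icc a b) fun t => f (Function.update x j t) ^ r) ^ (1 / r) ≤
        D * avg (Icc a b) fun t => f (Function.update x j t)) →
      ∀ a b : Fin n → ℝ, (∀ i, a i < b i) →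
        (avg (Icc a b) fun x => f x ^ r) ^ (1 / r) ≤ D ^ n * avg (Icc a b) f := by
  have hr0 : 0 < r := by linarith
  induction n with
  | zero =>
    intro f hf _ a b hab
    have hconst : ∀ c : ℝ≥0∞, (avg (Icc a b) fun _ => c) = c := fun c => by
      rw [avg, setLIntegral_const]
      exact ENNReal.mul_div_cancel_right (volume_Icc_pi_ne_zero hab) (volume_Icc_pi_ne_top a b)
    have hf' : f = fun _ => f a := funext fun x => congrArg f (Subsingleton.elim _ _)
    rw [hf', hconst, hconst, pow_zero, one_mul, ← ENNReal.rpow_mul, mul_one_div_cancel hr0.ne',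
      ENNReal.rpow_one]
  | succ n ih =>
    intro f hf hslice a b hab
    have hfr : Measurable fun x => f x ^ r := hf.pow_const r
    have hDn : D ^ n ≠ ∞ := ENNReal.pow_ne_top hD
    have hQ : ∀ i, Fin.removeNth 0 a i < Fin.removeNth 0 b i := fun i => hab _
    have hins : ∀ t : ℝ, Measurable fun y : Fin n → ℝ => f (Fin.insertNth 0 t y) := fun t =>
      (hf.comp (measurable_insertNth 0)).comp measurable_prodMk_left
    have hrest : ∀ᵐ t : ℝ, avg (Icc (Fin.removeNth 0 a) (Fin.removeNth 0 b))
          (fun y => f (Fin.insertNth 0 t y) ^ r) ≤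
        (D ^ n * avg (Icc (Fin.removeNth 0 a) (Fin.removeNth 0 b))
          fun y => f (Fin.insertNth 0 t y)) ^ r := by
      have hall : ∀ᵐ t : ℝ, ∀ j : Fin n, ∀ᵐ y : Fin n → ℝ, ∀ a b, a < b →
          (avg (Icc a b) fun s =>
            f (Fin.insertNth 0 t (Function.update y j s)) ^ r) ^ (1 / r) ≤
          D * avg (Icc a b) fun s => f (Fin.insertNth 0 t (Function.update y j s)) := by
        refine ae_all_iff.2 fun j => ?_
        filter_upwards [ae_ae_insertNth 0 (hslice j.succ)] with t ht
        filter_upwards [ht] with y hy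
        have : ∀ s, Function.update (Fin.insertNth 0 t y : Fin (n + 1) → ℝ) j.succ s =
            Fin.insertNth 0 t (Function.update y j s) := fun s => by
          simp only [Fin.insertNth_zero', Fin.cons_update]
        simpa only [this] using hy
      filter_upwards [hall] with t ht
      have h := ENNReal.rpow_le_rpow (ih _ (hins t) ht _ _ hQ) hr0.le
      rwa [← ENNReal.rpow_mul, one_div_mul_cancel hr0.ne', ENNReal.rpow_one] at h
    have hfirst : ∀ᵐ y : Fin n → ℝ, (avg (Icc (a 0) (b 0)) fun t =>
          f (Fin.insertNth 0 t y) ^ r) ^ (1 / r) ≤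
        D * avg (Icc (a 0) (b 0)) fun t => f (Fin.insertNth 0 t y) := by
      filter_upwards [ae_ae_insertNth' 0 (hslice 0)] with y hy
      -- The slice in direction `0` does not depend on the coordinate `0` of its base point, so one
      -- good `t` is enough.
      obtain ⟨t, ht⟩ := hy.exists
      have : ∀ s, Function.update (Fin.insertNth 0 t y : Fin (n + 1) → ℝ) 0 s =
          Fin.insertNth 0 s y := fun s => by
        simp only [Fin.insertNth_zero', Fin.update_cons_zero]
      simpa only [this] using ht _ _ (hab 0)
    calc (avg (Icc a b) fun x => f x ^ r) ^ (1 / r)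
        ≤ (avg (Icc (a 0) (b 0)) fun t => (D ^ n) ^ r *
            (avg (Icc (Fin.removeNth 0 a) (Fin.removeNth 0 b))
              fun y => f (Fin.insertNth 0 t y)) ^ r) ^ (1 / r) := by
          rw [avg_Icc_insertNth 0 hab hfr]
          refine ENNReal.rpow_le_rpow (avg_mono_ae ?_) (by positivity)
          filter_upwards [hrest] with t ht
          rwa [← ENNReal.mul_rpow_of_nonneg _ _ hr0.le]
      _ = D ^ n * (avg (Icc (a 0) (b 0)) fun t =>
            (avg (Icc (Fin.removeNth 0 a) (Fin.removeNth 0 b))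
              fun y => f (Fin.insertNth 0 t y)) ^ r) ^ (1 / r) := by
          rw [avg_const_mul _ _ (ENNReal.rpow_ne_top_of_nonneg hr0.le hDn),
            ENNReal.mul_rpow_of_nonneg _ _ (by positivity), ← ENNReal.rpow_mul,
            mul_one_div_cancel hr0.ne', ENNReal.rpow_one]
      -- Minkowski's inequality moves the power `r` from the averages in `y` onto the lines in
      -- direction `0`, where the one-dimensional bound applies.
      _ ≤ D ^ n * avg (Icc (Fin.removeNth 0 a) (Fin.removeNth 0 b)) fun y =>
            (avg (Icc (a 0) (b 0)) fun t => f (Fin.insertNth 0 t y) ^ r) ^ (1 / r) :=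
          mul_le_mul_right (avg_rpow_avg_le (hab 0) hQ
            (F := fun t y => f (Fin.insertNth 0 t y)) (hf.comp (measurable_insertNth 0)) hr) _
      _ ≤ D ^ n * avg (Icc (Fin.removeNth 0 a) (Fin.removeNth 0 b)) fun y =>
            D * avg (Icc (a 0) (b 0)) fun t => f (Fin.insertNth 0 t y) :=
          mul_le_mul_right (avg_mono_ae hfirst) _
      _ = D ^ (n + 1) * avg (Icc a b) f := by
          rw [avg_const_mul _ _ hD, ← avg_Icc_insertNth' 0 hab hf, pow_succ, mul_assoc]

/-! ### Reverse Hölder inequality for strong Muckenhoupt weights. -/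

theorem maximalFun_congr_ae {f g : ℝ → ℝ≥0∞} (h : ∀ᵐ x, f x = g x) :
    maximalFun f = maximalFun g := by
  funext x
  simp only [maximalFun, avg_congr_ae h]

theorem indicator_congr_ae {f g : ℝ → ℝ≥0∞} (h : ∀ᵐ x, f x = g x) (S : Set ℝ) :
    ∀ᵐ x, S.indicator f x = S.indicator g x := by
  filter_upwards [h] with x hx
  simp only [indicator, hx]

theorem IsWeight.aemeasurable {n : ℕ} {w : (Fin n → ℝ) → ℝ} (hw : IsWeight w) :
    AEMeasurable (fun x => ENNReal.ofReal (w x)) volume :=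
  hw.locallyIntegrable.aestronglyMeasurable.aemeasurable.ennreal_ofReal

theorem IsWeight.lintegral_Icc_ne_top {n : ℕ} {w : (Fin n → ℝ) → ℝ} (hw : IsWeight w)
    (a b : Fin n → ℝ) : ∫⁻ x in Icc a b, ENNReal.ofReal (w x) ≠ ∞ :=
  (hw.locallyIntegrable.integrableOn_isCompact isCompact_Icc).lintegral_lt_top.ne

/-- Fubini on the cubes `[-N, N]^(m+1)`; countably many cubes give one null set that serves all
intervals. -/
theorem ae_slice_lintegral_ne_top {m : ℕ} {g : (Fin (m + 1) → ℝ) → ℝ≥0∞} (hg : Measurable g)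
    (hfin : ∀ a b, ∫⁻ x in Icc a b, g x ≠ ∞) (j : Fin (m + 1)) :
    ∀ᵐ y : Fin m → ℝ, ∀ a b : ℝ, ∫⁻ t in Icc a b, g (j.insertNth t y) ≠ ∞ := by
  have hm : Measurable fun z : ℝ × (Fin m → ℝ) => g (j.insertNth z.1 z.2) :=
    hg.comp (measurable_insertNth j)
  have key : ∀ N : ℕ, ∀ᵐ y : Fin m → ℝ, y ∈ Icc (fun _ => -(N : ℝ)) (fun _ => (N : ℝ)) →
      ∫⁻ t in Icc (-(N : ℝ)) N, g (j.insertNth t y) < ∞ := by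
    intro N
    rw [← ae_restrict_iff' measurableSet_Icc]
    refine ae_lt_top (hm.lintegral_prod_left') ?_
    have h := hfin (fun _ => -(N : ℝ)) (fun _ => (N : ℝ))
    rwa [setLIntegral_Icc_insertNth j, lintegral_prod_symm _ hm.aemeasurable] at h
  filter_upwards [ae_all_iff.2 key] with y hy a b
  obtain ⟨N, hN⟩ := exists_nat_gt (max ‖y‖ (max (-a) b))
  have hN1 : ‖y‖ < N := (le_max_left _ _).trans_lt hN
  have hN2 : -a < N := ((le_max_left _ _).trans (le_max_right _ _)).trans_lt hN
  have hN3 : b < N := ((le_max_right _ _).trans (le_max_right _ _)).trans_lt hN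
  refine ne_top_of_le_ne_top (hy N ?_).ne
    (lintegral_mono_set (Icc_subset_Icc (by linarith) (by linarith)))
  have : ∀ i, |y i| ≤ N := fun i => (norm_le_pi_norm y i).trans hN1.le
  exact ⟨fun i => (abs_le.1 (this i)).1, fun i => (abs_le.1 (this i)).2⟩

theorem lintegral_maximalFun_le_of_aInftyConst_le {v : ℝ → ℝ} {u : ℝ → ℝ≥0∞}
    (hvu : ∀ᵐ t, ENNReal.ofReal (v t) = u t) {A : ℝ≥0∞} (hAt : A ≠ ∞) (hA : aInftyConst v ≤ A)
    {a b : ℝ} (hab : a < b) (hfin : ∫⁻ t in Icc a b, u t ≠ ∞) :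
    ∫⁻ x in Icc a b, maximalFun ((Icc a b).indicator u) x ≤ A * ∫⁻ t in Icc a b, u t := by
  have h := (le_iSup₂_of_le (f := fun a b => ⨆ _ : a < b,
    (∫⁻ x in Icc a b, maximalFun ((Icc a b).indicator fun t => ENNReal.ofReal (v t)) x) /
      ∫⁻ x in Icc a b, ENNReal.ofReal (v x)) a b (le_iSup_of_le hab le_rfl)).trans hA
  rw [maximalFun_congr_ae (indicator_congr_ae hvu _), lintegral_congr_ae (ae_restrict_of_ae hvu)]
    at h
  rwa [ENNReal.div_le_iff_le_mul (Or.inr hAt) (Or.inl hfin)] at h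

/-- The alternative `A < 1` is the degenerate case: since `v` is almost everywhere at most its
maximal function, `∫ v ≤ A ∫ v` forces `v` to vanish. -/
theorem avg_rpow_le_two_mul {v : ℝ → ℝ≥0∞} (hv : AEMeasurable v volume) {A : ℝ} (hA0 : 0 ≤ A)
    (hA : ∀ p q, p < q → ∫⁻ x in Icc p q, maximalFun ((Icc p q).indicator v) x ≤
      ENNReal.ofReal A * ∫⁻ x in Icc p q, v x)
    (hfin : ∀ p q, ∫⁻ x in Icc p q, v x ≠ ∞) {r : ℝ} (hr : 1 < r)
    (hAr : A < 1 ∨ A * (r - 1) ≤ 1 / 2) {a b : ℝ} (hab : a < b) :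
    (avg (Icc a b) fun t => v t ^ r) ^ (1 / r) ≤ 2 * avg (Icc a b) v := by
  have hr0 : 0 < r := by linarith
  rcases hAr with hA1 | hAr
  · have hle : ∫⁻ x in Icc a b, v x ≤ ENNReal.ofReal A * ∫⁻ x in Icc a b, v x := by
      refine le_trans (lintegral_mono_ae ?_) (hA a b hab)
      rw [ae_restrict_iff' measurableSet_Icc]
      filter_upwards [ae_le_maximalFun (hv.indicator measurableSet_Icc) (by
        rw [lintegral_indicator measurableSet_Icc]
        exact hfin a b)] with x hx hxI
      rwa [indicator_of_mem hxI] at hx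
    have h0 : ∫⁻ x in Icc a b, v x = 0 := by
      by_contra hne
      have := ENNReal.mul_lt_mul_left hne (hfin a b)
        (show ENNReal.ofReal A < 1 by rwa [ENNReal.ofReal_lt_one])
      rw [one_mul] at this
      exact absurd hle (not_le.2 this)
    rw [lintegral_eq_zero_iff' hv.restrict] at h0
    have : ∫⁻ x in Icc a b, v x ^ r = 0 := by
      rw [lintegral_eq_zero_iff' (hv.restrict.pow_const r)]
      filter_upwards [h0] with x hx
      simp only [Pi.zero_apply] at hx ⊢
      rw [hx, ENNReal.zero_rpow_of_pos hr0]
    rw [avg, this, ENNReal.zero_div, ENNReal.zero_rpow_of_pos (by positivity)]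
    exact zero_le
  · have h := avg_rpow_le_of_maximalFun hv hA0 hA (sub_pos.2 hr) hAr hab (hfin a b)
    rw [add_sub_cancel] at h
    calc (avg (Icc a b) fun t => v t ^ r) ^ (1 / r)
        ≤ (2 * avg (Icc a b) v ^ r) ^ (1 / r) := ENNReal.rpow_le_rpow h (by positivity)
      _ = 2 ^ (1 / r) * avg (Icc a b) v := by
          rw [ENNReal.mul_rpow_of_nonneg _ _ (by positivity), ← ENNReal.rpow_mul,
            mul_one_div_cancel hr0.ne', ENNReal.rpow_one]
      _ ≤ 2 * avg (Icc a b) v := by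
          refine mul_le_mul_left ?_ _
          conv_rhs => rw [← ENNReal.rpow_one 2]
          exact ENNReal.rpow_le_rpow_of_exponent_le (by norm_num) (by
            rw [div_le_one hr0]; exact hr.le)

/-- The weight is replaced by a measurable representative `g`, whose slices agree almost everywhere
with those of `w` along almost every line; maximal functions and averages do not see the difference.
-/
theorem reverseHolder_two_pow {m : ℕ} {w : (Fin (m + 1) → ℝ) → ℝ} (hw : MemAInftyStar w) {r : ℝ}
    (hr : 1 < r) (hAr : (aInftyStarConst w).toReal < 1 ∨
      (aInftyStarConst w).toReal * (r - 1) ≤ 1 / 2) : ReverseHolder w r (2 ^ (m + 1)) := by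
  obtain ⟨hw, hfinA⟩ := hw
  set g := hw.aemeasurable.mk _ with hgdef
  have hgm : Measurable g := hw.aemeasurable.measurable_mk
  have hfg : ∀ᵐ x, ENNReal.ofReal (w x) = g x := hw.aemeasurable.ae_eq_mk
  have hgfin : ∀ a b, ∫⁻ x in Icc a b, g x ≠ ∞ := fun a b => by
    rw [← lintegral_congr_ae (ae_restrict_of_ae hfg)]
    exact hw.lintegral_Icc_ne_top a b
  intro a b hab
  rw [avg_congr_ae (hfg.mono fun x hx => by rw [hx]), avg_congr_ae hfg]
  have hB : ENNReal.ofReal (2 ^ (m + 1)) = 2 ^ (m + 1) := by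
    rw [ENNReal.ofReal_pow zero_le_two, ENNReal.ofReal_ofNat]
  rw [hB]
  refine avg_rpow_le_of_slices hr (by norm_num) (m + 1) g hgm (fun j => ?_) a b hab
  have hslice : ∀ᵐ y : Fin m → ℝ, ∀ a b, a < b →
      (avg (Icc a b) fun t => g (j.insertNth t y) ^ r) ^ (1 / r) ≤
        2 * avg (Icc a b) fun t => g (j.insertNth t y) := by
    filter_upwards [ae_slice_lintegral_ne_top hgm hgfin j, ae_ae_insertNth' j hfg,
      ENNReal.ae_le_essSup fun y : Fin m → ℝ => aInftyConst (slice w j y)] with y hy1 hy2 hy3 a b hab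
    have hle : aInftyConst (slice w j y) ≤ ENNReal.ofReal (aInftyStarConst w).toReal := by
      rw [ENNReal.ofReal_toReal hfinA.ne]
      exact hy3.trans (le_iSup (fun j : Fin (m + 1) =>
        essSup (fun y : Fin m → ℝ => aInftyConst (slice w j y)) volume) j)
    have hm : Measurable fun t : ℝ => g (j.insertNth t y) :=
      (hgm.comp (measurable_insertNth j)).comp measurable_prodMk_right
    exact avg_rpow_le_two_mul hm.aemeasurable ENNReal.toReal_nonneg
      (fun p q hpq => lintegral_maximalFun_le_of_aInftyConst_le hy2 ENNReal.ofReal_ne_top hle hpq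
        (hy1 p q)) hy1 hr hAr hab
  filter_upwards [ae_removeNth j hslice] with x hx
  simpa only [Fin.insertNth_removeNth] using hx

theorem ReverseHolder.mono {n : ℕ} {w : (Fin n → ℝ) → ℝ} {r B B' : ℝ} (h : ReverseHolder w r B)
    (hB : B ≤ B') : ReverseHolder w r B' := fun a b hab =>
  (h a b hab).trans (mul_le_mul_left (ENNReal.ofReal_le_ofReal hB) _)

theorem reverseHolder_one {n : ℕ} (w : (Fin n → ℝ) → ℝ) : ReverseHolder w 1 1 := fun a b _ => by
  simp

theorem reverseHolder_of_memAInftyStar {m : ℕ} {w : (Fin (m + 1) → ℝ) → ℝ}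
    (hw : MemAInftyStar w) {r : ℝ} (hr : 1 ≤ r)
    (hr' : r < 1 + 1 / (3 * ((m + 1 : ℕ) : ℝ) * (aInftyStarConst w).toReal - 1)) :
    ReverseHolder w r (2 ^ (m + 1) *
      (1 - (r - 1) * (3 * ((m + 1 : ℕ) : ℝ) * (aInftyStarConst w).toReal - 1)) ^ (-(1 / r))) := by
  set A := (aInftyStarConst w).toReal with hA
  set X := 3 * ((m + 1 : ℕ) : ℝ) * A - 1 with hX
  -- If `X ≤ 0` then `1 / X ≤ 0`, also with the convention `1 / 0 = 0`, and no `r ≥ 1` is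
  -- admissible.
  have hX0 : 0 < X := by
    have : 0 < 1 / X := by linarith
    exact one_div_pos.1 this
  have hrX : (r - 1) * X < 1 := by
    have : r - 1 < 1 / X := by linarith
    rwa [lt_div_iff₀ hX0] at this
  have hfac : (1 : ℝ) ≤ (1 - (r - 1) * X) ^ (-(1 / r)) := by
    refine Real.one_le_rpow_of_pos_of_le_one_of_nonpos (by linarith) ?_ ?_
    · nlinarith [mul_nonneg (sub_nonneg.2 hr) hX0.le]
    · have : 0 < 1 / r := by positivity
      linarith
  have h2 : (1 : ℝ) ≤ 2 ^ (m + 1) := one_le_pow₀ one_le_two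
  rcases hr.eq_or_lt with rfl | hr1
  · exact (reverseHolder_one w).mono (one_le_mul_of_one_le_of_one_le h2 hfac)
  · refine (reverseHolder_two_pow hw hr1 ?_).mono
      (le_mul_of_one_le_right (by positivity) hfac)
    rcases lt_or_ge A 1 with h | h
    · exact Or.inl h
    · right
      have hm : (1 : ℝ) ≤ ((m + 1 : ℕ) : ℝ) := by exact_mod_cast Nat.le_add_left 1 m
      -- Here `c = 3` is used: `3 n A - 1 ≥ 3 A - 1 ≥ 2 A` because `A ≥ 1`.
      have : 2 * A ≤ X := by nlinarith
      nlinarith [mul_le_mul_of_nonneg_left this (sub_nonneg.2 hr)]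

/-! ### Weak type inequality and the converse on the line. -/

/-- The weak type inequality for the maximal function, with the integral restricted to the set
where the function exceeds half of the level. -/
theorem mul_volume_lt_maximalFun_le {f : ℝ → ℝ≥0∞} (hfin : ∫⁻ x, f x ≠ ∞) {l : ℝ≥0∞}
    (hl0 : l ≠ 0) (hlt : l ≠ ∞) :
    l * volume {x | l < maximalFun f x} ≤ 10 * ∫⁻ x, {y | l / 2 < f y}.indicator f x := by
  set h := {y | l / 2 < f y}.indicator f with hh
  set t : Set (ℝ × ℝ) := {p | p.1 < p.2 ∧ l < avg (Icc p.1 p.2) f} with ht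
  have hball : ∀ p : ℝ × ℝ,
      Metric.closedBall ((p.1 + p.2) / 2) ((p.2 - p.1) / 2) = Icc p.1 p.2 := fun p =>
    (Real.Icc_eq_closedBall _ _).symm
  -- Vitali's covering lemma needs bounded lengths: an interval with average above `l` is shorter
  -- than `(∫ f) / l`.
  obtain ⟨u, hut, hdisj, hcov⟩ := Vitali.exists_disjoint_subfamily_covering_enlargement_closedBall
    t (fun p => (p.1 + p.2) / 2) (fun p => (p.2 - p.1) / 2) ((∫⁻ x, f x) / l).toReal (by
      rintro p ⟨hp, hpl⟩
      rw [lt_avg_Icc_iff hp] at hpl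
      have h1 : ENNReal.ofReal (p.2 - p.1) ≤ (∫⁻ x, f x) / l := by
        rw [ENNReal.le_div_iff_mul_le (Or.inl hl0) (Or.inl hlt), mul_comm]
        exact hpl.le.trans (setLIntegral_le_lintegral _ _)
      have h2 := (ENNReal.ofReal_le_iff_le_toReal (ENNReal.div_ne_top hfin hl0)).1 h1
      linarith) 5 (by norm_num)
  simp only [hball] at hdisj hcov
  have hcount : u.Countable := hdisj.countable_of_nonempty_interior fun p hp => by
    rw [interior_Icc, nonempty_Ioo]
    exact (hut hp).1
  have hsub : {x | l < maximalFun f x} ⊆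
      ⋃ p ∈ u, Metric.closedBall ((p.1 + p.2) / 2) (5 * ((p.2 - p.1) / 2)) := by
    intro x hx
    obtain ⟨a, b, hab, hxab, hl⟩ := lt_maximalFun_iff.1 hx
    obtain ⟨p, hp, hsub⟩ := hcov (a, b) ⟨hab, hl⟩
    exact mem_iUnion₂.2 ⟨p, hp, hsub hxab⟩
  have hterm : ∀ p ∈ u,
      l * volume (Metric.closedBall ((p.1 + p.2) / 2) (5 * ((p.2 - p.1) / 2))) ≤
        10 * ∫⁻ x in Icc p.1 p.2, h x := by
    intro p hp
    obtain ⟨hp1, hp2⟩ := hut hp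
    rw [lt_avg_Icc_iff hp1] at hp2
    set J := ENNReal.ofReal (p.2 - p.1) with hJ
    have h1 : ∫⁻ x in Icc p.1 p.2, f x ≤ (∫⁻ x in Icc p.1 p.2, h x) + l / 2 * J := by
      rw [hJ, ← Real.volume_Icc, ← setLIntegral_const, ← lintegral_add_right _ measurable_const]
      refine lintegral_mono fun x => ?_
      by_cases hx : l / 2 < f x
      · simp [hh, hx]
      · exact le_add_left (not_lt.1 hx)
    have hfinJ : l / 2 * J ≠ ∞ :=
      ENNReal.mul_ne_top (ENNReal.div_ne_top hlt (by norm_num)) ENNReal.ofReal_ne_top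
    -- The part of `f` below `l / 2` accounts for at most half of the mass `l |J|`; dilation by `5`
    -- and this halving make the constant `10`.
    have h2 : l / 2 * J ≤ ∫⁻ x in Icc p.1 p.2, h x := by
      have h3 := hp2.le.trans h1
      rw [← ENNReal.add_halves l, add_mul] at h3
      simp only [ENNReal.add_halves] at h3
      exact (ENNReal.add_le_add_iff_right hfinJ).1 h3
    calc l * volume (Metric.closedBall ((p.1 + p.2) / 2) (5 * ((p.2 - p.1) / 2)))
        = 10 * (l / 2 * J) := by
          rw [Real.volume_closedBall, show 2 * (5 * ((p.2 - p.1) / 2)) = 5 * (p.2 - p.1) by ring,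
            ENNReal.ofReal_mul (by norm_num), ENNReal.ofReal_ofNat, ← hJ]
          conv_lhs => rw [← ENNReal.add_halves l]
          ring
      _ ≤ _ := mul_le_mul_right h2 _
  calc l * volume {x | l < maximalFun f x}
      ≤ l * ∑' p : u, volume (Metric.closedBall ((p.1.1 + p.1.2) / 2)
          (5 * ((p.1.2 - p.1.1) / 2))) :=
        mul_le_mul_right ((measure_mono hsub).trans (measure_biUnion_le _ hcount _)) _
    _ ≤ ∑' p : u, 10 * ∫⁻ x in Icc p.1.1 p.1.2, h x := by
        rw [← ENNReal.tsum_mul_left]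
        exact ENNReal.tsum_le_tsum fun p => hterm p p.2
    _ = 10 * ∫⁻ x in ⋃ p ∈ u, Icc p.1 p.2, h x := by
        rw [ENNReal.tsum_mul_left, lintegral_biUnion hcount (fun p _ => measurableSet_Icc) hdisj]
    _ ≤ _ := mul_le_mul_right (setLIntegral_le_lintegral _ _) _

theorem lintegral_inv_Ioc {α β : ℝ} (hα : 0 < α) (hαβ : α ≤ β) :
    ∫⁻ t in Ioc α β, ENNReal.ofReal t⁻¹ = ENNReal.ofReal (Real.log (β / α)) := by
  have hβ : 0 < β := hα.trans_le hαβ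
  have hint : IntervalIntegrable (fun t : ℝ => t⁻¹) volume α β :=
    intervalIntegral.intervalIntegrable_inv (fun t ht => by
      rw [uIcc_of_le hαβ] at ht
      linarith [ht.1]) continuousOn_id
  rw [← integral_inv_of_pos hα hβ, intervalIntegral.integral_of_le hαβ,
    ofReal_integral_eq_lintegral_ofReal hint.1]
  rw [EventuallyLE, ae_restrict_iff' measurableSet_Ioc]
  refine ae_of_all _ fun t ht => ?_
  have : 0 < t := hα.trans ht.1
  exact (inv_pos.2 this).le

theorem lintegral_rpow_Ioi {β r : ℝ} (hβ : 0 < β) (hr : 1 < r) :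
    ∫⁻ t in Ioi β, ENNReal.ofReal (t ^ (-r)) = ENNReal.ofReal (β ^ (1 - r) / (r - 1)) := by
  have h : β ^ (1 - r) / (r - 1) = ∫ t in Ioi β, t ^ (-r) := by
    rw [integral_Ioi_rpow_of_lt (by linarith) hβ, show -r + 1 = 1 - r by ring,
      show 1 - r = -(r - 1) by ring, neg_div_neg_eq]
  rw [h, ofReal_integral_eq_lintegral_ofReal (integrableOn_Ioi_rpow_of_lt (by linarith) hβ)]
  rw [EventuallyLE, ae_restrict_iff' measurableSet_Ioi]
  exact ae_of_all _ fun t ht => (Real.rpow_pos_of_pos (hβ.trans ht) _).le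

/-- The layer-cake formula is applied to truncations, followed by monotone convergence, since the
maximal function may be infinite. -/
theorem lintegral_maximalFun_le_lintegral_level {f : ℝ → ℝ≥0∞} (S : Set ℝ) :
    ∫⁻ x in S, maximalFun f x ≤
      ∫⁻ t in Ioi (0 : ℝ), volume.restrict S {x | ENNReal.ofReal t < maximalFun f x} := by
  have hM : Measurable (maximalFun f) := measurable_maximalFun f
  refine le_of_tendsto' (lintegral_tendsto_of_tendsto_of_monotone
      (f := fun (N : ℕ) x => min (maximalFun f x) N) (fun N => ?_) ?_ ?_) fun N => ?_
  · exact (hM.min measurable_const).aemeasurable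
  · exact ae_of_all _ fun x N N' hNN' => min_le_min_left _ (by exact_mod_cast hNN')
  · refine ae_of_all _ fun x => ?_
    simpa using (tendsto_const_nhds (x := maximalFun f x)).min ENNReal.tendsto_nat_nhds_top
  · have h := lintegral_rpow_eq_layercake (volume.restrict S) (hM.min measurable_const)
      (ENNReal.natCast_ne_top N) (fun x => min_le_right _ _) zero_lt_one
    simp only [ENNReal.rpow_one, ENNReal.ofReal_one, one_mul, sub_self, Real.rpow_zero,
      mul_one] at h
    rw [h]
    refine lintegral_mono fun t => measure_mono fun x hx => ?_
    have hx' : ENNReal.ofReal t < min (maximalFun f x) N := hx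
    exact hx'.trans_le (min_le_left _ _)

/-- A reverse Hölder inequality for `u` on an interval bounds the local maximal function of `u` in
the mean. -/
theorem lintegral_maximalFun_le_of_reverseHolder {u : ℝ → ℝ≥0∞} {a b r B : ℝ} (hab : a < b)
    (hr : 1 < r) (hB : 1 ≤ B)
    (hRH : (avg (Icc a b) fun t => u t ^ r) ^ (1 / r) ≤ ENNReal.ofReal B * avg (Icc a b) u)
    (hfin : ∫⁻ x in Icc a b, u x ≠ ∞) :
    ∫⁻ x in Icc a b, maximalFun ((Icc a b).indicator u) x ≤
      ENNReal.ofReal (11 * (r / (r - 1)) * (1 + Real.log B)) * ∫⁻ x in Icc a b, u x := by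
  have hr0 : 0 < r := by linarith
  have hr1 : 0 < r - 1 := by linarith
  set f := (Icc a b).indicator u with hf
  have hff : ∫⁻ x, f x = ∫⁻ x in Icc a b, u x := lintegral_indicator measurableSet_Icc _
  rcases eq_or_ne (∫⁻ x in Icc a b, u x) 0 with h0 | h0
  · have hM : ∀ x, maximalFun f x = 0 := by
      intro x
      by_contra hne
      obtain ⟨s, t, hst, -, hlt⟩ := lt_maximalFun_iff.1 (pos_iff_ne_zero.2 hne)
      rw [lt_avg_Icc_iff hst, zero_mul] at hlt
      exact absurd ((setLIntegral_le_lintegral _ _).trans_eq (hff.trans h0)) (not_le.2 hlt)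
    simp [hM]
  obtain ⟨V, hV⟩ : ∃ V : ℝ, V = (∫⁻ x in Icc a b, u x).toReal := ⟨_, rfl⟩
  have hVu : ∫⁻ x in Icc a b, u x = ENNReal.ofReal V := by rw [hV, ENNReal.ofReal_toReal hfin]
  have hV0 : 0 < V := by rw [hV]; exact ENNReal.toReal_pos h0 hfin
  have hba : 0 < b - a := sub_pos.2 hab
  set α := V / (b - a) with hα
  have hα0 : 0 < α := by positivity
  have hαV : α * (b - a) = V := div_mul_cancel₀ _ hba.ne'
  have hB0 : 0 < B := by linarith
  have havg : avg (Icc a b) u = ENNReal.ofReal α := by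
    rw [avg, Real.volume_Icc, hVu, ← ENNReal.ofReal_div_of_pos hba]
  have hW : ∫⁻ x in Icc a b, u x ^ r ≤ ENNReal.ofReal (B ^ r * α ^ (r - 1) * V) := by
    have h := ENNReal.rpow_le_rpow hRH hr0.le
    rw [← ENNReal.rpow_mul, one_div_mul_cancel hr0.ne', ENNReal.rpow_one, havg,
      ← ENNReal.ofReal_mul hB0.le, ENNReal.ofReal_rpow_of_pos (by positivity),
      avg_Icc_le_iff hab, ← ENNReal.ofReal_mul (by positivity)] at h
    refine h.trans_eq ?_
    rw [← hαV, Real.mul_rpow hB0.le hα0.le, Real.rpow_sub_one hα0.ne']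
    field_simp
  -- Chosen so that `T^(r-1) = 2^(r-1) B^r`, which makes the bound for the levels above `T α`
  -- exactly `10 V / (r - 1)`.
  set T := 2 * B ^ (r / (r - 1)) with hT
  have hBT : 1 ≤ B ^ (r / (r - 1)) := Real.one_le_rpow hB (by positivity)
  have hT0 : 0 < T := by positivity
  have hT1 : 1 ≤ T := by linarith
  have hαβ : α ≤ T * α := le_mul_of_one_le_left hα0.le hT1
  set φ : ℝ → ℝ≥0∞ := fun t =>
    volume.restrict (Icc a b) {x | ENNReal.ofReal t < maximalFun f x} with hφ
  have hweak : ∀ t : ℝ, 0 < t → ENNReal.ofReal t * φ t ≤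
      10 * ∫⁻ x in Icc a b, {y | ENNReal.ofReal t / 2 < f y}.indicator f x := by
    intro t ht
    refine (mul_le_mul_right (Measure.restrict_apply_le _ _) _).trans
      ((mul_volume_lt_maximalFun_le (hff ▸ hfin) (by simpa using ht)
        ENNReal.ofReal_ne_top).trans (mul_le_mul_right ?_ _))
    rw [← lintegral_indicator measurableSet_Icc]
    refine lintegral_mono fun x => ?_
    by_cases hx : x ∈ Icc a b
    · rw [indicator_of_mem hx]
    · rw [indicator_of_notMem hx, indicator_apply]
      split_ifs
      · rw [hf, indicator_of_notMem hx]
      · exact le_rfl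
  have hsmall : ∫⁻ t in Ioc 0 α, φ t ≤ ENNReal.ofReal V := by
    calc ∫⁻ t in Ioc 0 α, φ t ≤ ∫⁻ t in Ioc 0 α, ENNReal.ofReal (b - a) := by
          refine lintegral_mono fun t => (measure_mono (subset_univ _)).trans_eq ?_
          rw [Measure.restrict_apply_univ, Real.volume_Icc]
      _ = ENNReal.ofReal V := by
          rw [setLIntegral_const, Real.volume_Ioc, sub_zero, ← ENNReal.ofReal_mul hba.le,
            mul_comm, hαV]
  have hmid : ∫⁻ t in Ioc α (T * α), φ t ≤ ENNReal.ofReal (10 * V * Real.log T) := by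
    calc ∫⁻ t in Ioc α (T * α), φ t
        ≤ ∫⁻ t in Ioc α (T * α), ENNReal.ofReal (10 * V) * ENNReal.ofReal t⁻¹ := by
          refine setLIntegral_mono' measurableSet_Ioc fun t ht => ?_
          have ht0 : 0 < t := hα0.trans ht.1
          rw [ENNReal.ofReal_inv_of_pos ht0, ← div_eq_mul_inv,
            ENNReal.le_div_iff_mul_le (Or.inl (by simpa using ht0))
              (Or.inl ENNReal.ofReal_ne_top), mul_comm]
          refine (hweak t ht0).trans ?_
          rw [ENNReal.ofReal_mul (by norm_num), ENNReal.ofReal_ofNat, ← hVu]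
          refine mul_le_mul_right (setLIntegral_mono' measurableSet_Icc fun x hx => ?_) _
          exact (indicator_le_self _ _ x).trans_eq (indicator_of_mem hx u)
      _ = ENNReal.ofReal (10 * V * Real.log T) := by
          rw [lintegral_const_mul' _ _ ENNReal.ofReal_ne_top, lintegral_inv_Ioc hα0 hαβ,
            mul_div_cancel_right₀ _ hα0.ne', ← ENNReal.ofReal_mul (by positivity)]
  have hlarge : ∫⁻ t in Ioi (T * α), φ t ≤ ENNReal.ofReal (10 * V / (r - 1)) := by
    set c := 10 * (2 ^ (r - 1) * (B ^ r * α ^ (r - 1) * V)) with hc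
    have hc0 : 0 < c := by positivity
    have hTα : 0 < T * α := by positivity
    calc ∫⁻ t in Ioi (T * α), φ t
        ≤ ∫⁻ t in Ioi (T * α), ENNReal.ofReal c * ENNReal.ofReal (t ^ (-r)) := by
          refine setLIntegral_mono' measurableSet_Ioi fun t ht => ?_
          have ht0 : 0 < t := hTα.trans ht
          -- Where `u > t / 2`, one has `u ≤ (2 / t)^(r-1) u^r`.
          have hind : ∫⁻ x in Icc a b, {y | ENNReal.ofReal t / 2 < f y}.indicator f x ≤
              ENNReal.ofReal ((2 / t) ^ (r - 1)) * ∫⁻ x in Icc a b, u x ^ r := by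
            rw [← lintegral_const_mul' _ _ ENNReal.ofReal_ne_top]
            refine setLIntegral_mono' measurableSet_Icc fun x hx => ?_
            rw [indicator_apply]
            split_ifs with hxl
            · have hfu : f x = u x := indicator_of_mem hx u
              rw [mem_ofPred_eq, hfu] at hxl
              rw [hfu]
              have h1 : 1 ≤ ENNReal.ofReal (2 / t) * u x := by
                have : ENNReal.ofReal t / 2 = ENNReal.ofReal (t / 2) := by
                  rw [ENNReal.ofReal_div_of_pos two_pos, ENNReal.ofReal_ofNat]
                rw [this] at hxl
                calc (1 : ℝ≥0∞) = ENNReal.ofReal (2 / t) * ENNReal.ofReal (t / 2) := by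
                      rw [← ENNReal.ofReal_mul (by positivity),
                        show 2 / t * (t / 2) = 1 by field_simp, ENNReal.ofReal_one]
                  _ ≤ _ := mul_le_mul_right hxl.le _
              have h2 := ENNReal.rpow_le_rpow h1 hr1.le
              rw [ENNReal.one_rpow, ENNReal.mul_rpow_of_nonneg _ _ hr1.le,
                ENNReal.ofReal_rpow_of_pos (by positivity)] at h2
              calc u x ≤ (ENNReal.ofReal ((2 / t) ^ (r - 1)) * u x ^ (r - 1)) * u x :=
                    le_mul_of_one_le_left zero_le h2
                _ = ENNReal.ofReal ((2 / t) ^ (r - 1)) * u x ^ r := by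
                    conv_rhs => rw [show r = (r - 1) + 1 by ring,
                      ENNReal.rpow_add_of_nonneg _ _ hr1.le zero_le_one, ENNReal.rpow_one]
                    rw [mul_assoc, add_sub_cancel_right]
            · exact zero_le
          have h3 : ENNReal.ofReal t * φ t ≤ ENNReal.ofReal (c * t ^ (-r) * t) := by
            refine (hweak t ht0).trans ((mul_le_mul_right (hind.trans
              (mul_le_mul_right hW _)) _).trans_eq ?_)
            rw [← ENNReal.ofReal_mul (by positivity), ← ENNReal.ofReal_ofNat 10,
              ← ENNReal.ofReal_mul (by norm_num)]
            congr 1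
            rw [Real.div_rpow zero_le_two ht0.le, Real.rpow_neg ht0.le, hc,
              Real.rpow_sub_one ht0.ne']
            field_simp
          rw [ENNReal.ofReal_mul (by positivity), mul_comm] at h3
          rw [← ENNReal.ofReal_mul hc0.le]
          exact (ENNReal.mul_le_mul_iff_left (by simpa using ht0) ENNReal.ofReal_ne_top).1 h3
      _ = ENNReal.ofReal (10 * V / (r - 1)) := by
          rw [lintegral_const_mul' _ _ ENNReal.ofReal_ne_top, lintegral_rpow_Ioi hTα hr,
            ← ENNReal.ofReal_mul hc0.le]
          congr 1
          have hBr : (B ^ (r / (r - 1))) ^ (r - 1) = B ^ r := by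
            rw [← Real.rpow_mul hB0.le, div_mul_cancel₀ _ hr1.ne']
          rw [show 1 - r = -(r - 1) by ring, Real.rpow_neg hTα.le, Real.mul_rpow hT0.le hα0.le, hT,
            Real.mul_rpow zero_le_two (by positivity), hBr, hc]
          have h2 : (2 : ℝ) ^ (r - 1) ≠ 0 := (Real.rpow_pos_of_pos two_pos _).ne'
          have h3 : B ^ r ≠ 0 := (Real.rpow_pos_of_pos hB0 _).ne'
          have h4 : α ^ (r - 1) ≠ 0 := (Real.rpow_pos_of_pos hα0 _).ne'
          field_simp
  have hlogB : 0 ≤ Real.log B := Real.log_nonneg hB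
  have hlogT : Real.log T ≤ 1 + r / (r - 1) * Real.log B := by
    rw [hT, Real.log_mul two_ne_zero (by positivity), Real.log_rpow hB0]
    linarith [Real.log_two_lt_d9]
  have hlogT0 : 0 ≤ Real.log T := Real.log_nonneg hT1
  have hunion : Ioi (0 : ℝ) = Ioc 0 α ∪ (Ioc α (T * α) ∪ Ioi (T * α)) := by
    rw [Ioc_union_Ioi_eq_Ioi hαβ, Ioc_union_Ioi_eq_Ioi hα0.le]
  calc ∫⁻ x in Icc a b, maximalFun f x ≤ ∫⁻ t in Ioi (0 : ℝ), φ t :=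
        lintegral_maximalFun_le_lintegral_level _
    _ ≤ ENNReal.ofReal V +
        (ENNReal.ofReal (10 * V * Real.log T) + ENNReal.ofReal (10 * V / (r - 1))) := by
        rw [hunion]
        exact (lintegral_union_le _ _ _).trans
          (add_le_add hsmall ((lintegral_union_le _ _ _).trans (add_le_add hmid hlarge)))
    _ ≤ ENNReal.ofReal (11 * (r / (r - 1)) * (1 + Real.log B)) * ∫⁻ x in Icc a b, u x := by
        rw [hVu, ← ENNReal.ofReal_add (by positivity) (by positivity),
          ← ENNReal.ofReal_add (by positivity) (by positivity),
          ← ENNReal.ofReal_mul (by positivity)]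
        refine ENNReal.ofReal_le_ofReal ?_
        -- With `r' = 1 + 1 / (r - 1)`, the three pieces divided by `V` add up to at most `1 + 10 (1
        -- + r' log B) + 10 (r' - 1) ≤ 11 r' (1 + log B)`.
        have hrr : r / (r - 1) = 1 + 1 / (r - 1) := by field_simp; ring
        have hp : 0 < 1 / (r - 1) := by positivity
        have h5 : 10 * V / (r - 1) = 10 * V * (1 / (r - 1)) := by ring
        have h6 : 10 * V * Real.log T ≤ 10 * V * (1 + r / (r - 1) * Real.log B) :=
          mul_le_mul_of_nonneg_left hlogT (by positivity)
        rw [h5]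
        rw [hrr] at h6 ⊢
        have h7 : 0 ≤ V * (1 / (r - 1)) := by positivity
        have h8 : 0 ≤ V * ((1 + 1 / (r - 1)) * Real.log B) := by positivity
        nlinarith

/-! ### From rectangles to slices. -/

theorem closedBall_eq_Icc_pi {n : ℕ} (y : Fin n → ℝ) {d : ℝ} (hd : 0 ≤ d) :
    Metric.closedBall y d = Icc (fun i => y i - d) (fun i => y i + d) := by
  rw [closedBall_pi y hd, ← pi_univ_Icc]
  simp only [Real.closedBall_eq_Icc]

/-- The approximating intervals stay inside `(a, b)`, so the limit holds even when the integral over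
`[a, b]` is infinite. -/
theorem tendsto_avg_Icc {u : ℝ → ℝ≥0∞} (hu : AEMeasurable u volume) {a b : ℝ} (hab : a < b)
    {s t : ℕ → ℝ} (hs : Tendsto s atTop (𝓝 a)) (ht : Tendsto t atTop (𝓝 b)) (has : ∀ k, a < s k)
    (htb : ∀ k, t k < b) :
    Tendsto (fun k => avg (Icc (s k) (t k)) u) atTop (𝓝 (avg (Icc a b) u)) := by
  have hcov : AECover (volume.restrict (Ioo a b)) atTop fun k => Icc (s k) (t k) :=
    aecover_Ioo_of_Icc hs ht
  have h := hcov.lintegral_tendsto_of_countably_generated hu.restrict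
  have hsub : ∀ k, (volume.restrict (Ioo a b)).restrict (Icc (s k) (t k)) =
      volume.restrict (Icc (s k) (t k)) := fun k => by
    rw [Measure.restrict_restrict measurableSet_Icc, inter_eq_left.2]
    exact fun x hx => ⟨(has k).trans_le hx.1, hx.2.trans_lt (htb k)⟩
  simp only [hsub] at h
  rw [setLIntegral_congr Ioo_ae_eq_Icc] at h
  simp only [avg, Real.volume_Icc]
  refine ENNReal.Tendsto.div h (Or.inr (by simpa using hab))
    ((ENNReal.continuous_ofReal.tendsto _).comp (ht.sub hs)) (Or.inl ENNReal.ofReal_ne_top)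

/-- Rational endpoints suffice, so that only countably many exceptional null sets of slices have to
be discarded. -/
theorem reverseHolder_Icc_of_rat {u : ℝ → ℝ≥0∞} (hu : AEMeasurable u volume) {r B : ℝ}
    (h : ∀ s t : ℚ, s < t → (avg (Icc (s : ℝ) t) fun x => u x ^ r) ^ (1 / r) ≤
      ENNReal.ofReal B * avg (Icc (s : ℝ) t) u) {a b : ℝ} (hab : a < b) :
    (avg (Icc a b) fun x => u x ^ r) ^ (1 / r) ≤ ENNReal.ofReal B * avg (Icc a b) u := by
  have hba : 0 < b - a := sub_pos.2 hab
  have hpos : ∀ k : ℕ, 0 < (b - a) / (k + 2) := fun k => by positivity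
  have hs : ∀ k : ℕ, ∃ q : ℚ, a < q ∧ (q : ℝ) < a + (b - a) / (k + 2) := fun k =>
    exists_rat_btwn (by linarith [hpos k])
  have ht : ∀ k : ℕ, ∃ q : ℚ, b - (b - a) / (k + 2) < q ∧ (q : ℝ) < b := fun k =>
    exists_rat_btwn (by linarith [hpos k])
  choose s hs1 hs2 using hs
  choose t ht1 ht2 using ht
  have hz : Tendsto (fun k : ℕ => (b - a) / ((k : ℝ) + 2)) atTop (𝓝 0) :=
    tendsto_const_nhds.div_atTop (tendsto_atTop_add_const_right _ _ tendsto_natCast_atTop_atTop)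
  have hst : ∀ k, s k < t k := fun k => by
    have h2 : (b - a) / ((k : ℝ) + 2) ≤ (b - a) / 2 :=
      div_le_div_of_nonneg_left hba.le two_pos (by linarith [(Nat.cast_nonneg k : (0 : ℝ) ≤ k)])
    have : (s k : ℝ) < t k := by linarith [hs2 k, ht1 k]
    exact_mod_cast this
  have hsl : Tendsto (fun k => (s k : ℝ)) atTop (𝓝 a) :=
    tendsto_of_tendsto_of_tendsto_of_le_of_le tendsto_const_nhds
      (by simpa using tendsto_const_nhds.add hz) (fun k => (hs1 k).le) fun k => (hs2 k).le
  have htl : Tendsto (fun k => (t k : ℝ)) atTop (𝓝 b) :=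
    tendsto_of_tendsto_of_tendsto_of_le_of_le
      (by simpa using tendsto_const_nhds.sub hz) tendsto_const_nhds
      (fun k => (ht1 k).le) fun k => (ht2 k).le
  refine le_of_tendsto_of_tendsto'
    ((ENNReal.continuous_rpow_const.tendsto _).comp
      (tendsto_avg_Icc (hu.pow_const r) hab hsl htl hs1 ht2))
    (ENNReal.Tendsto.const_mul (tendsto_avg_Icc hu hab hsl htl hs1 ht2)
      (Or.inr ENNReal.ofReal_ne_top)) fun k => h _ _ (hst k)

/-- A reverse Hölder inequality on rectangles passes to almost every slice. -/
theorem ae_slice_reverseHolder {m : ℕ} {g : (Fin (m + 1) → ℝ) → ℝ≥0∞} (hg : Measurable g)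
    (hfin : ∀ a b, ∫⁻ x in Icc a b, g x ≠ ∞) {r B : ℝ} (hr : 0 < r)
    (hRH : ∀ a b : Fin (m + 1) → ℝ, (∀ i, a i < b i) →
      (avg (Icc a b) fun x => g x ^ r) ^ (1 / r) ≤ ENNReal.ofReal B * avg (Icc a b) g)
    (j : Fin (m + 1)) :
    ∀ᵐ y : Fin m → ℝ, ∀ a b : ℝ, a < b →
      (avg (Icc a b) fun t => g (j.insertNth t y) ^ r) ^ (1 / r) ≤
        ENNReal.ofReal B * avg (Icc a b) fun t => g (j.insertNth t y) := by
  have hm : Measurable fun z : ℝ × (Fin m → ℝ) => g (j.insertNth z.1 z.2) :=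
    hg.comp (measurable_insertNth j)
  have hgr : Measurable fun x => g x ^ r := hg.pow_const r
  have key : ∀ s t : ℚ, s < t → ∀ᵐ y : Fin m → ℝ,
      (avg (Icc (s : ℝ) t) fun x => g (j.insertNth x y) ^ r) ^ (1 / r) ≤
        ENNReal.ofReal B * avg (Icc (s : ℝ) t) fun x => g (j.insertNth x y) := by
    intro s t hst
    have hst' : (s : ℝ) < t := by exact_mod_cast hst
    set H : (Fin m → ℝ) → ℝ≥0∞ := fun y => avg (Icc (s : ℝ) t) fun x => g (j.insertNth x y) with hH
    set G : (Fin m → ℝ) → ℝ≥0∞ :=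
      fun y => avg (Icc (s : ℝ) t) fun x => g (j.insertNth x y) ^ r with hG
    have hHm : Measurable H := hm.lintegral_prod_left'.div_const _
    have hGm : Measurable G := (hm.pow_const r).lintegral_prod_left'.div_const _
    set lo : (Fin m → ℝ) → ℝ → Fin (m + 1) → ℝ :=
      fun y d => j.insertNth (s : ℝ) fun i => y i - d with hlo
    set hi : (Fin m → ℝ) → ℝ → Fin (m + 1) → ℝ :=
      fun y d => j.insertNth (t : ℝ) fun i => y i + d with hhi
    have hlohi : ∀ y d, 0 < d → ∀ i, lo y d i < hi y d i := by
      intro y d hd i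
      simp only [hlo, hhi]
      refine Fin.succAboveCases j ?_ (fun k => ?_) i
      · simpa using hst'
      · simp only [Fin.insertNth_apply_succAbove]
        linarith
    have hbox : ∀ y d, 0 < d → ∀ f : (Fin (m + 1) → ℝ) → ℝ≥0∞, Measurable f →
        avg (Icc (lo y d) (hi y d)) f = avg (Metric.closedBall y d) fun y =>
          avg (Icc (s : ℝ) t) fun x => f (j.insertNth x y) := by
      intro y d hd f hf
      rw [avg_Icc_insertNth' j (hlohi y d hd) hf, closedBall_eq_Icc_pi y hd.le]
      simp [hlo, hhi]
    -- By Fubini, the hypothesis on the box with side `[s, t]` in direction `j` and cross-section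
    -- the cube of radius `d` about `y` compares the averages of `G` and `H` over that cube.
    have hbound : ∀ y d, 0 < d → avg (Metric.closedBall y d) G ^ (1 / r) ≤
        ENNReal.ofReal B * avg (Metric.closedBall y d) H := by
      intro y d hd
      rw [← hbox y d hd _ hg, ← hbox y d hd _ hgr]
      exact hRH _ _ (hlohi y d hd)
    have hHavg : ∀ d, 0 < d → avg (Metric.closedBall 0 d) H ≠ ∞ := by
      intro d hd
      rw [← hbox 0 d hd _ hg]
      exact ENNReal.div_ne_top (hfin _ _) (volume_Icc_pi_ne_zero (hlohi 0 d hd))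
    -- The local integrability of `G`, needed for differentiation, comes from the reverse Hölder
    -- inequality itself.
    have hGavg : ∀ d, 0 < d → avg (Metric.closedBall 0 d) G ≠ ∞ := by
      intro d hd htop
      have h := hbound 0 d hd
      rw [htop, ENNReal.top_rpow_of_pos (by positivity), top_le_iff] at h
      exact ENNReal.mul_ne_top ENNReal.ofReal_ne_top (hHavg d hd) h
    have hloc : ∀ F : (Fin m → ℝ) → ℝ≥0∞, (∀ d, 0 < d → avg (Metric.closedBall 0 d) F ≠ ∞) →
        ∀ R : ℝ, ∫⁻ x in Metric.closedBall 0 R, F x ≠ ∞ := by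
      intro F hF R
      have h1 : (0 : ℝ) < max R 1 := lt_max_of_lt_right one_pos
      refine ne_top_of_le_ne_top ?_
        (lintegral_mono_set (Metric.closedBall_subset_closedBall (le_max_left R 1)))
      intro htop
      refine hF _ h1 ?_
      rw [avg, htop, ENNReal.top_div_of_ne_top]
      exact measure_closedBall_lt_top.ne
    filter_upwards [ae_tendsto_avg_closedBall hHm.aemeasurable (hloc H hHavg),
      ae_tendsto_avg_closedBall hGm.aemeasurable (hloc G hGavg)] with y hy1 hy2
    refine le_of_tendsto_of_tendsto ((ENNReal.continuous_rpow_const.tendsto _).comp hy2)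
      (ENNReal.Tendsto.const_mul hy1 (Or.inr ENNReal.ofReal_ne_top)) ?_
    filter_upwards [self_mem_nhdsWithin] with d hd
    exact hbound y d hd
  have key' : ∀ᵐ y : Fin m → ℝ, ∀ s t : ℚ, s < t →
      (avg (Icc (s : ℝ) t) fun x => g (j.insertNth x y) ^ r) ^ (1 / r) ≤
        ENNReal.ofReal B * avg (Icc (s : ℝ) t) fun x => g (j.insertNth x y) := by
    simp only [ae_all_iff]
    exact key
  filter_upwards [key'] with y hy a b hab
  have hmy : Measurable fun t : ℝ => g (j.insertNth t y) := hm.comp measurable_prodMk_right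
  exact reverseHolder_Icc_of_rat hmy.aemeasurable hy hab

theorem aInftyStarConst_le_of_reverseHolder {m : ℕ} {w : (Fin (m + 1) → ℝ) → ℝ} (hw : IsWeight w)
    {r B : ℝ} (hr : 1 < r) (hB : 1 ≤ B) (hRH : ReverseHolder w r B) :
    aInftyStarConst w ≤ ENNReal.ofReal (11 * (r / (r - 1)) * (1 + Real.log B)) := by
  set g := hw.aemeasurable.mk _ with hgdef
  have hgm : Measurable g := hw.aemeasurable.measurable_mk
  have hfg : ∀ᵐ x, ENNReal.ofReal (w x) = g x := hw.aemeasurable.ae_eq_mk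
  have hgfin : ∀ a b, ∫⁻ x in Icc a b, g x ≠ ∞ := fun a b => by
    rw [← lintegral_congr_ae (ae_restrict_of_ae hfg)]
    exact hw.lintegral_Icc_ne_top a b
  have hgRH : ∀ a b : Fin (m + 1) → ℝ, (∀ i, a i < b i) →
      (avg (Icc a b) fun x => g x ^ r) ^ (1 / r) ≤ ENNReal.ofReal B * avg (Icc a b) g := by
    intro a b hab
    have h := hRH a b hab
    rwa [avg_congr_ae (hfg.mono fun x hx => by rw [hx]), avg_congr_ae hfg] at h
  refine iSup_le fun j => essSup_le_of_ae_le _ ?_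
  filter_upwards [ae_slice_lintegral_ne_top hgm hgfin j, ae_ae_insertNth' j hfg,
    ae_slice_reverseHolder hgm hgfin (by linarith) hgRH j] with y hy1 hy2 hy3
  refine iSup₂_le fun a b => iSup_le fun hab => ENNReal.div_le_of_le_mul ?_
  have hy2' : ∀ᵐ t, ENNReal.ofReal (slice w j y t) = g (j.insertNth t y) := hy2
  rw [maximalFun_congr_ae (indicator_congr_ae hy2' _), lintegral_congr_ae (ae_restrict_of_ae hy2')]
  exact lintegral_maximalFun_le_of_reverseHolder hab hr hB (hy3 a b hab) (hy1 a b)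

end StrongWeights

/-- The dimension is `n = m + 1 ≥ 1`. In the first part `c` is a numerical constant and `C n`
depends only on the dimension; in the second part `K` is a numerical constant. -/
theorem theorem2 :
    (∃ c : ℝ, 1 < c ∧ ∃ C : ℕ → ℝ, ∀ (m : ℕ) (w : (Fin (m + 1) → ℝ) → ℝ),
      StrongWeights.MemAInftyStar w →
      ∀ r : ℝ, 1 ≤ r →
        r < 1 + 1 / (c * ((m + 1 : ℕ) : ℝ) * (StrongWeights.aInftyStarConst w).toReal - 1) →
        StrongWeights.ReverseHolder w r
          (C (m + 1) *
            (1 - (r - 1) *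
              (c * ((m + 1 : ℕ) : ℝ) * (StrongWeights.aInftyStarConst w).toReal - 1)) ^
                (-(1 / r)))) ∧
    (∃ K : ℝ, 0 < K ∧ ∀ (m : ℕ) (w : (Fin (m + 1) → ℝ) → ℝ),
      StrongWeights.IsWeight w →
      ∀ r B : ℝ, 1 < r → 1 ≤ B → StrongWeights.ReverseHolder w r B →
        StrongWeights.MemAInftyStar w ∧
        StrongWeights.aInftyStarConst w ≤
          ENNReal.ofReal (K * (r / (r - 1)) * (1 + Real.log B))) := by
  refine ⟨⟨3, by norm_num, fun n => 2 ^ n, fun m w hw r hr hr' =>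
    StrongWeights.reverseHolder_of_memAInftyStar hw hr hr'⟩, 11, by norm_num,
    fun m w hw r B hr hB hRH => ?_⟩
  have h := StrongWeights.aInftyStarConst_le_of_reverseHolder hw hr hB hRH
  exact ⟨⟨hw, h.trans_lt ENNReal.ofReal_lt_top⟩, h⟩
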